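/- Let $D=\{|z|<1\}$, $T=\{|\zeta|=1\}$, and let $m$ be the normalized Lebesgue measure on $T$. Let $H^\infty$ be the space of bounded analytic functions on $D$ with $\|h\|_{H^\infty}=\sup_{z\in D}|h(z)|$, and let $H^1$ be the space of analytic functions $g$ on $D$ with $\|g\|_{H^1}=\sup_{0\le r<1}\int_T|g(r\zeta)|\,dm(\zeta)<\infty$. For a function $g$ on $D$, write $g(\zeta)=\lim_{r\to1-}g(r\zeta)$ for its radial boundary values at $\zeta\in T$. **Theorem 2.** Let $f$ be analytic in $D$ with $f'\in H^1$. Then $f\in H^\infty$; for all $h\in H^\infty$ and $z\in D$ the integral $$(T_fh)(z)=\int_T\frac{\overline{f(\zeta)}\,h(\zeta)}{1-\overline{\zeta}z}\,dm(\zeta)$$ converges absolutely; and $h\mapsto T_fh$ is a bounded linear operator $T_f:H^\infty\to H^\infty$ whose operator norm satisfies $$\|T_f\|\le\|f\|_{H^\infty}+\pi\,\|f'\|_{H^1}.$$ -/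

import Mathlib

open Set Filter Topology Metric
open scoped BoundedContinuousFunction ComplexConjugate

noncomputable section

namespace HardyToeplitz

/-- The open unit disc `D`, as a type. -/
abbrev Disc : Type := ball (0 : ℂ) 1

/-- Extension of a function on the disc by `0` to all of `ℂ`. Only its values inside the disc
are ever used. -/
def extendZero (h : Disc → ℂ) : ℂ → ℂ := fun z =>
  open Classical in if hz : z ∈ ball (0 : ℂ) 1 then h ⟨z, hz⟩ else 0

theorem extendZero_coe (h : Disc → ℂ) (z : Disc) : extendZero h z = h z := by
  simp only [extendZero, dif_pos z.2]

theorem extendZero_add (g h : Disc → ℂ) :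
    extendZero (g + h) = extendZero g + extendZero h := by
  funext z
  by_cases hz : z ∈ ball (0 : ℂ) 1
  · simp only [extendZero, dif_pos hz, Pi.add_apply]
  · simp only [extendZero, dif_neg hz, Pi.add_apply, add_zero]

theorem extendZero_smul (c : ℂ) (h : Disc → ℂ) :
    extendZero (c • h) = c • extendZero h := by
  funext z
  by_cases hz : z ∈ ball (0 : ℂ) 1
  · simp only [extendZero, dif_pos hz, Pi.smul_apply]
  · simp only [extendZero, dif_neg hz, Pi.smul_apply, smul_zero]

theorem extendZero_zero : extendZero (0 : Disc → ℂ) = 0 := by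
  funext z
  by_cases hz : z ∈ ball (0 : ℂ) 1
  · simp only [extendZero, dif_pos hz, Pi.zero_apply]
  · simp only [extendZero, dif_neg hz, Pi.zero_apply]

/-- The space `H^∞` of bounded analytic functions on the disc, with the norm
`‖h‖ = sup_{z ∈ D} |h z|` inherited from the bounded continuous functions. -/
def HInfty : Submodule ℂ (Disc →ᵇ ℂ) where
  carrier := {h | DifferentiableOn ℂ (extendZero h) (ball 0 1)}
  add_mem' := by
    intro a b ha hb
    have hab : extendZero ⇑(a + b) = extendZero a + extendZero b := extendZero_add a b
    simp only [mem_ofPred_eq, hab]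
    exact DifferentiableOn.add ha hb
  zero_mem' := by
    have h0 : extendZero ⇑(0 : Disc →ᵇ ℂ) = 0 := extendZero_zero
    simp only [mem_ofPred_eq, h0]
    exact differentiableOn_const 0
  smul_mem' := by
    intro c a ha
    have hca : extendZero ⇑(c • a) = c • extendZero a := extendZero_smul c a
    simp only [mem_ofPred_eq, hca]
    exact DifferentiableOn.const_smul ha c

/-- The `L¹` means `∫_T |g(rζ)| dm(ζ)` for `0 ≤ r < 1`, where `m` is the normalized Lebesgue
measure on the unit circle `T`. -/
def h1Means (g : ℂ → ℂ) : Set ℝ :=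
  (fun r : ℝ => Real.circleAverage (fun z => ‖g z‖) 0 r) '' Ico 0 1

/-- `g ∈ H¹`: `g` is analytic in the disc and its `L¹` means are bounded. -/
def MemH1 (g : ℂ → ℂ) : Prop :=
  DifferentiableOn ℂ g (ball 0 1) ∧ BddAbove (h1Means g)

/-- The `H¹` norm `sup_{0 ≤ r < 1} ∫_T |g(rζ)| dm(ζ)` (for `g ∈ H¹`). -/
def h1Norm (g : ℂ → ℂ) : ℝ := sSup (h1Means g)

/-- The boundary value at `ζ ∈ T` of a function on the disc: its radial limit
`lim_{r → 1-} g(rζ)`. -/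
def boundaryValue (g : ℂ → ℂ) (ζ : ℂ) : ℂ :=
  limUnder (𝓝[<] (1 : ℝ)) fun r : ℝ => g (r * ζ)

/-- The integrand `conj f(ζ) * h(ζ) / (1 - conj ζ * z)` of the Toeplitz operator, on `|ζ| = 1`. -/
def toeplitzIntegrand (f h : ℂ → ℂ) (z ζ : ℂ) : ℂ :=
  conj (boundaryValue f ζ) * boundaryValue h ζ / (1 - conj ζ * z)

/-- `(T_f h)(z) = ∫_T conj f(ζ) * h(ζ) / (1 - conj ζ * z) dm(ζ)`. -/
def toeplitz (f h : ℂ → ℂ) (z : ℂ) : ℂ :=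
  Real.circleAverage (toeplitzIntegrand f h z) 0 1

end HardyToeplitz

end

namespace HardyToeplitz

open MeasureTheory

/-! The heart of the proof is a chordal formula, first for `f` and `h` analytic across the circle.
The Toeplitz integral at `z` is a Cauchy integral of `conj f * h`, which is not analytic. Subtract
the value at `z` and write the difference at a boundary point `b` as the integral of the derivative
along the segment from `z` to `b`. This produces terms in `f'` and in `h'`. Integrating the angular
derivative of `conj f * h` over the closed curve formed by the points `z + t (b - z)`, with `t`
fixed, trades the `h'` terms for `f'` terms (`integral_tangential`). What remains is `conj f(z)
h(z)` plus `(2πi)⁻¹` times a double integral of `conj f' * h` against `chordKernel`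
(`integral_chordal_representation`).

When `|z| = 1`, the kernel has modulus `|b - z|`, so the double integral is at most `sup |h|` times
the integral of `|f'|` with respect to arc length along the chords from `z`, integrated over the
endpoint angle. By the maximum principle, a bound on the circle suffices.

The chord integrals are controlled by the Poisson formula for `(ζ - a)(ζ - b) g(ζ)`. At a point `w`
of the chord, `|w - a||w - b| = 1 - |w|²` cancels the Poisson numerator. Integrating the resulting
kernel along the chord gives, by the inscribed angle theorem, the length of the arc opposite to `ζ`
(`integral_chord_kernel`). Averaging that arc length over the endpoint gives at most `2π²` in total,
and `2π² / (2π)` is the constant `π`. The same chord estimate on a diameter bounds `f` itself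
(`norm_sub_le_of_memH1_deriv`).

General `f` and `h` are replaced by the dilations `f(r z)` and `h(r z)`, whose bounds are uniform in
`r`. The limit `r → 1` uses dominated convergence and Fatou's theorem (`ae_exists_radial_limit`).
The latter comes from differentiating a Lipschitz primitive: it is differentiable along the circle
almost everywhere, and at such a point its complex derivative has a radial limit. -/

/-! ### Fatou's theorem on radial limits of bounded analytic functions -/

theorem norm_circleAverage_le (f : ℂ → ℂ) (c : ℂ) (R : ℝ) :
    ‖Real.circleAverage f c R‖ ≤ Real.circleAverage (fun z => ‖f z‖) c R := by
  rw [Real.circleAverage_def, Real.circleAverage_def, norm_smul, Real.norm_of_nonneg (by positivity),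
    smul_eq_mul]
  gcongr
  exact intervalIntegral.norm_integral_le_integral_norm (by positivity)

theorem continuousOn_sphere_of_diffContOnCl {G : ℂ → ℂ} (hG : DiffContOnCl ℂ G (ball 0 1)) :
    ContinuousOn G (sphere 0 1) :=
  hG.continuousOn_ball.mono sphere_subset_closedBall

/-- On the unit circle the Herglotz–Riesz kernel is `2ζ/(ζ - v) - 1`, so its average against `G` is
`2 G v` minus a constant; differentiating in `v` gives the Cauchy formula for the derivative. -/
theorem deriv_eq_circleAverage {G : ℂ → ℂ} (hG : DiffContOnCl ℂ G (ball 0 1)) {w : ℂ}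
    (hw : w ∈ ball (0 : ℂ) 1) :
    deriv G w = Real.circleAverage (fun ζ => ζ / (ζ - w) ^ 2 * G ζ) 0 1 := by
  have hGs := continuousOn_sphere_of_diffContOnCl hG
  have hGi : CircleIntegrable G 0 1 := hGs.circleIntegrable zero_le_one
  have key : ∀ v ∈ ball (0 : ℂ) 1,
      Real.circleAverage (fun ζ => herglotzRieszKernel 0 v ζ • G ζ) 0 1
        = 2 * G v - Real.circleAverage G 0 1 := by
    intro v hv
    have h1 := DiffContOnCl.circleAverage_smul_div (c := 0) (R := 1) (f := G)
      (by simpa using hG) (w := v) (by simpa using hv)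
    have hne : ∀ ζ ∈ sphere (0 : ℂ) 1, ζ - v ≠ 0 := fun ζ hζ =>
      sub_ne_zero.2 (sphere_disjoint_ball.ne_of_mem hζ hv)
    have hi : CircleIntegrable (fun ζ => ((ζ - 0) / (ζ - v)) • G ζ) 0 1 := by
      apply ContinuousOn.circleIntegrable zero_le_one
      exact ((continuousOn_id.sub continuousOn_const).div
        (continuousOn_id.sub continuousOn_const) hne).smul hGs
    rw [← h1, ← smul_eq_mul, ← Real.circleAverage_fun_smul, ← Real.circleAverage_fun_sub _ hGi]
    · refine Real.circleAverage_congr_sphere fun ζ hζ => ?_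
      have := hne ζ (by simpa using hζ)
      simp only [herglotzRieszKernel_def, sub_zero, smul_eq_mul]
      field_simp
      ring
    · exact hi.const_smul
  have h2 := hasDerivAt_circleAverage_herglotzRieszKernel_smul hGi hw
  have hev : (fun v => Real.circleAverage (fun ζ => herglotzRieszKernel 0 v ζ • G ζ) 0 1)
      =ᶠ[𝓝 w] fun v => 2 * G v - Real.circleAverage G 0 1 := by
    filter_upwards [isOpen_ball.mem_nhds hw] with v hv using key v hv
  have h3 := h2.congr_of_eventuallyEq hev.symm
  have h4 : HasDerivAt (fun v => 2 * G v - Real.circleAverage G 0 1) (2 * deriv G w) w :=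
    (((hG.differentiableAt isOpen_ball hw).hasDerivAt).const_mul 2).sub_const _
  have h5 := h4.unique h3
  have h6 : Real.circleAverage (fun ζ => (2 * ζ / (ζ - w) ^ 2) • G ζ) 0 1
      = 2 * Real.circleAverage (fun ζ => ζ / (ζ - w) ^ 2 * G ζ) 0 1 := by
    rw [← smul_eq_mul, ← Real.circleAverage_fun_smul]
    congr 1; ext ζ; simp only [smul_eq_mul]; ring
  rw [h6] at h5
  exact mul_left_cancel₀ two_ne_zero h5

theorem circleAverage_div_sub_sq_eq_zero {G : ℂ → ℂ} (hG : DiffContOnCl ℂ G (ball 0 1)) {w : ℂ}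
    (hw : 1 < ‖w‖) :
    Real.circleAverage (fun ζ => ζ / (ζ - w) ^ 2 * G ζ) 0 1 = 0 := by
  rw [Real.circleAverage_eq_circleIntegral one_ne_zero]
  have hne : ∀ ζ ∈ closedBall (0 : ℂ) 1, ζ - w ≠ 0 := by
    intro ζ hζ h
    rw [mem_closedBall_zero_iff, sub_eq_zero.1 h] at hζ
    linarith
  have : ∮ z in C(0, 1), (z - 0)⁻¹ • (z / (z - w) ^ 2 * G z)
      = ∮ z in C(0, 1), ((z - w) ^ 2)⁻¹ • G z := by
    refine circleIntegral.integral_congr zero_le_one fun z hz => ?_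
    have h0 : z ≠ 0 := by rintro rfl; simp at hz
    simp only [sub_zero, smul_eq_mul]
    field_simp
  rw [this, DiffContOnCl.circleIntegral_eq_zero zero_le_one, smul_zero]
  refine DiffContOnCl.smul (DifferentiableOn.diffContOnCl ?_) hG
  rw [closure_ball 0 one_ne_zero]
  intro ζ hζ
  exact (((differentiableAt_id.sub_const w).pow 2).inv
    (pow_ne_zero 2 (hne ζ hζ))).differentiableWithinAt

theorem norm_ofReal_mul_sub_comm {ζ ξ : ℂ} (hζ : ‖ζ‖ = 1) (hξ : ‖ξ‖ = 1) (r : ℝ) :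
    ‖(r : ℂ) * ζ - ξ‖ = ‖ζ - r * ξ‖ := by
  rw [← sq_eq_sq₀ (norm_nonneg _) (norm_nonneg _), ← Complex.normSq_eq_norm_sq,
    ← Complex.normSq_eq_norm_sq]
  have h1 : ζ.re * ζ.re + ζ.im * ζ.im = 1 := by
    rw [← Complex.normSq_apply, Complex.normSq_eq_norm_sq, hζ]; norm_num
  have h2 : ξ.re * ξ.re + ξ.im * ξ.im = 1 := by
    rw [← Complex.normSq_apply, Complex.normSq_eq_norm_sq, hξ]; norm_num
  simp only [Complex.normSq_apply, Complex.sub_re, Complex.sub_im, Complex.re_ofReal_mul,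
    Complex.im_ofReal_mul]
  linear_combination (r ^ 2 - 1) * (h1 - h2)

/-- The points `rξ` and `ξ/r` are mirror images in the circle, so their distances to `ζ` have the
constant ratio `r`. Factoring the difference of squares then gains a factor `1 - r` and leaves a
cubic denominator, which absorbs both error terms in `tendsto_deriv_radial`. -/
theorem norm_kernel_sub_reflected_le {ζ ξ : ℂ} (hζ : ‖ζ‖ = 1) (hξ : ‖ξ‖ = 1) {r : ℝ}
    (hr0 : 0 < r) (hr1 : r < 1) :
    ‖ζ / (ζ - r * ξ) ^ 2 - ζ / (ζ - ξ / r) ^ 2‖ ≤ 4 * (1 - r) / ‖ζ - r * ξ‖ ^ 3 := by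
  have hrc : (r : ℂ) ≠ 0 := by exact_mod_cast hr0.ne'
  set d := ‖ζ - r * ξ‖ with hd
  have hdpos : 0 < d := by
    have := norm_sub_norm_le ζ (r * ξ)
    rw [norm_mul, hζ, hξ, Complex.norm_real, Real.norm_of_nonneg hr0.le] at this
    linarith
  have hd' : ‖ζ - ξ / r‖ = d / r := by
    rw [hd, ← norm_ofReal_mul_sub_comm hζ hξ]
    have : ζ - ξ / r = (r * ζ - ξ) / r := by field_simp
    rw [this, norm_div, Complex.norm_real, Real.norm_of_nonneg hr0.le]
  have hz : ζ - r * ξ ≠ 0 := norm_pos_iff.1 hdpos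
  have hz' : ζ - ξ / r ≠ 0 := norm_pos_iff.1 (by rw [hd']; positivity)
  have e : ζ / (ζ - r * ξ) ^ 2 - ζ / (ζ - ξ / r) ^ 2
      = ζ * ((r - 1 / r) * ξ) * ((ζ - r * ξ) + (ζ - ξ / r))
        / ((ζ - r * ξ) ^ 2 * (ζ - ξ / r) ^ 2) := by
    rw [div_sub_div _ _ (pow_ne_zero 2 hz) (pow_ne_zero 2 hz')]
    congr 1
    ring
  have hn : ‖((r : ℂ) - 1 / r)‖ = (1 - r ^ 2) / r := by
    have : ((r : ℂ) - 1 / r) = ((-((1 - r ^ 2) / r) : ℝ) : ℂ) := by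
      push_cast; field_simp; ring
    rw [this, Complex.norm_real, norm_neg, Real.norm_of_nonneg]
    have : r ^ 2 ≤ 1 := by nlinarith
    exact div_nonneg (by linarith) hr0.le
  rw [e, norm_div, norm_mul, norm_mul, norm_mul, norm_mul, norm_pow, norm_pow, hζ, hξ, hn, hd', ← hd]
  have h1 : ‖(ζ - r * ξ) + (ζ - ξ / r)‖ ≤ d + d / r := by
    refine (norm_add_le _ _).trans_eq ?_
    rw [hd']
  have hr2 : 0 ≤ 1 - r ^ 2 := by nlinarith
  calc 1 * ((1 - r ^ 2) / r * 1) * ‖(ζ - r * ξ) + (ζ - ξ / r)‖ / (d ^ 2 * (d / r) ^ 2)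
      ≤ 1 * ((1 - r ^ 2) / r * 1) * (d + d / r) / (d ^ 2 * (d / r) ^ 2) := by gcongr
    _ = (1 - r) * (1 + r) ^ 2 / d ^ 3 := by field_simp; ring
    _ ≤ 4 * (1 - r) / d ^ 3 := by
      have : (1 - r) * (1 + r) ^ 2 ≤ 4 * (1 - r) := by nlinarith
      gcongr

theorem circleAverage_inv_norm_sub_sq {w : ℂ} (hw : w ∈ ball (0 : ℂ) 1) :
    Real.circleAverage (fun ζ => (1 - ‖w‖ ^ 2) / ‖ζ - w‖ ^ 2) 0 1 = 1 := by
  have h := DiffContOnCl.circleAverage_poissonKernel_smul' (f := fun _ : ℂ => (1 : ℂ)) (c := 0)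
    (R := 1) diffContOnCl_const hw
  have h2 : Real.circleAverage (fun ζ => (((1 - ‖w‖ ^ 2) / ‖ζ - w‖ ^ 2 : ℝ) : ℂ)) 0 1 = 1 := by
    rw [← h]
    refine Real.circleAverage_congr_sphere fun ζ hζ => ?_
    have : ‖ζ‖ = 1 := by simpa using hζ
    simp [this]
  rw [Real.circleAverage_def, intervalIntegral.integral_ofReal, Complex.real_smul] at h2
  rw [Real.circleAverage_def, smul_eq_mul]
  exact_mod_cast h2

theorem sub_ne_zero_of_mem_sphere_of_mem_ball {w : ℂ} (hw : w ∈ ball (0 : ℂ) 1) {ζ : ℂ}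
    (hζ : ζ ∈ sphere (0 : ℂ) 1) : ζ - w ≠ 0 :=
  sub_ne_zero.2 (sphere_disjoint_ball.ne_of_mem hζ hw)

/-- If the boundary values of `G` are differentiable along the circle at `ξ` in the quantitative
sense of the hypothesis, then the derivative of `G` has a radial limit at `ξ`. -/
theorem tendsto_deriv_radial {G : ℂ → ℂ} (hG : DiffContOnCl ℂ G (ball 0 1)) {ξ c : ℂ}
    (hξ : ‖ξ‖ = 1)
    (h : ∀ ε > 0, ∃ M, 0 ≤ M ∧ ∀ w ∈ sphere (0 : ℂ) 1,
      ‖G w - G ξ - c * (w - ξ)‖ ≤ ε * ‖w - ξ‖ + M * ‖w - ξ‖ ^ 3) :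
    Tendsto (fun r : ℝ => deriv G (r * ξ)) (𝓝[<] 1) (𝓝 c) := by
  have key : ∀ ε > 0, ∃ M, 0 ≤ M ∧ ∀ r ∈ Ioo (0 : ℝ) 1,
      ‖deriv G (r * ξ) - c‖ ≤ 8 * ε + M * (1 - r) := by
    intro ε hε
    obtain ⟨M, hM, hb⟩ := h ε hε
    -- The constants come from the kernel bound `4(1 - r)/d³` and `|ζ - ξ| ≤ 2d`: the linear error
    -- gives `8ε(1 - r)/d²`, at most `8ε` times the Poisson kernel, and the cubic one gives `4 · 8 ·
    -- M (1 - r)`.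
    refine ⟨32 * M, by positivity, fun r hr => ?_⟩
    have hz : (r * ξ : ℂ) ∈ ball (0 : ℂ) 1 := by
      rw [mem_ball_zero_iff, norm_mul, hξ, Complex.norm_real, Real.norm_of_nonneg hr.1.le]
      linarith [hr.2]
    have hz' : 1 < ‖ξ / r‖ := by
      rw [norm_div, hξ, Complex.norm_real, Real.norm_of_nonneg hr.1.le]
      exact (one_lt_div hr.1).2 hr.2
    set k : ℂ → ℂ := fun w => G w - G ξ - c * (w - ξ) with hk
    have hkd : DiffContOnCl ℂ k (ball 0 1) := by
      refine (hG.sub_const _).sub ?_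
      exact Differentiable.diffContOnCl (by fun_prop)
    have hdk : deriv k (r * ξ) = deriv G (r * ξ) - c := by
      have h1 := ((hG.differentiableAt isOpen_ball hz).hasDerivAt.sub_const (G ξ)).sub
        (((hasDerivAt_id' (r * ξ : ℂ)).sub_const ξ).const_mul c)
      rw [mul_one] at h1
      exact h1.deriv
    have hks := continuousOn_sphere_of_diffContOnCl hkd
    have hne := fun ζ (hζ : ζ ∈ sphere (0 : ℂ) 1) => sub_ne_zero_of_mem_sphere_of_mem_ball hz hζ
    have hne' : ∀ ζ ∈ sphere (0 : ℂ) 1, ζ - ξ / r ≠ 0 := by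
      intro ζ hζ h0
      rw [← sub_eq_zero.1 h0] at hz'
      simp only [mem_sphere_zero_iff_norm] at hζ
      linarith
    have c1 : ContinuousOn (fun ζ : ℂ => ζ / (ζ - r * ξ) ^ 2) (sphere 0 1) :=
      continuousOn_id.div ((continuousOn_id.sub continuousOn_const).pow 2)
        fun ζ hζ => pow_ne_zero 2 (hne ζ hζ)
    have c2 : ContinuousOn (fun ζ : ℂ => ζ / (ζ - ξ / r) ^ 2) (sphere 0 1) :=
      continuousOn_id.div ((continuousOn_id.sub continuousOn_const).pow 2)
        fun ζ hζ => pow_ne_zero 2 (hne' ζ hζ)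
    -- Subtracting the kernel at `ξ/r` changes nothing, because that point lies outside the closed
    -- disc and its integral vanishes by Cauchy's theorem.
    have hrep : deriv k (r * ξ) = Real.circleAverage
        (fun ζ => (ζ / (ζ - r * ξ) ^ 2 - ζ / (ζ - ξ / r) ^ 2) * k ζ) 0 1 := by
      have hs := Real.circleAverage_fun_sub ((c1.mul hks).circleIntegrable zero_le_one)
        ((c2.mul hks).circleIntegrable zero_le_one)
      simp only [Pi.mul_apply] at hs
      have h0 := circleAverage_div_sub_sq_eq_zero hkd hz'
      rw [deriv_eq_circleAverage hkd hz]
      simp only [sub_mul]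
      refine Eq.trans ?_ hs.symm
      exact ((congrArg _ h0).trans (sub_zero _)).symm
    have cP : ContinuousOn (fun ζ : ℂ => (1 - ‖(r * ξ : ℂ)‖ ^ 2) / ‖ζ - r * ξ‖ ^ 2)
        (sphere 0 1) :=
      continuousOn_const.div ((continuousOn_id.sub continuousOn_const).norm.pow 2)
        fun ζ hζ => pow_ne_zero 2 (norm_ne_zero_iff.2 (hne ζ hζ))
    have cP' : ContinuousOn (fun ζ : ℂ =>
        (8 * ε) • ((1 - ‖(r * ξ : ℂ)‖ ^ 2) / ‖ζ - r * ξ‖ ^ 2)) (sphere 0 1) :=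
      continuousOn_const.fun_smul cP
    rw [← hdk, hrep]
    calc _ ≤ Real.circleAverage
          (fun ζ => ‖(ζ / (ζ - r * ξ) ^ 2 - ζ / (ζ - ξ / r) ^ 2) * k ζ‖) 0 1 :=
          norm_circleAverage_le _ _ _
      _ ≤ Real.circleAverage (fun ζ => (8 * ε) • ((1 - ‖(r * ξ : ℂ)‖ ^ 2) / ‖ζ - r * ξ‖ ^ 2)
            + 32 * M * (1 - r)) 0 1 := by
          refine Real.circleAverage_mono (((c1.sub c2).mul hks).norm.circleIntegrable zero_le_one)
            ((cP'.add continuousOn_const).circleIntegrable zero_le_one)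
            fun ζ hζ => ?_
          rw [abs_one] at hζ
          have hζ1 : ‖ζ‖ = 1 := by simpa using hζ
          have hd : 0 < ‖ζ - r * ξ‖ := norm_pos_iff.2 (hne ζ hζ)
          have hd1 : 1 - r ≤ ‖ζ - r * ξ‖ := by
            have := norm_sub_norm_le ζ (r * ξ)
            rwa [norm_mul, hζ1, hξ, Complex.norm_real, Real.norm_of_nonneg hr.1.le, mul_one] at this
          have hd2 : ‖ζ - ξ‖ ≤ 2 * ‖ζ - r * ξ‖ := by
            have : ζ - ξ = (ζ - r * ξ) + ((r - 1 : ℝ) : ℂ) * ξ := by push_cast; ring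
            rw [this]
            refine (norm_add_le _ _).trans ?_
            rw [norm_mul, hξ, Complex.norm_real, Real.norm_of_nonpos (by linarith [hr.2])]
            linarith
          have hn : ‖(r * ξ : ℂ)‖ = r := by
            rw [norm_mul, hξ, Complex.norm_real, Real.norm_of_nonneg hr.1.le, mul_one]
          have h1r : 0 < 1 - r := by linarith [hr.2]
          rw [norm_mul, hn, smul_eq_mul]
          set d := ‖ζ - r * ξ‖
          calc _ ≤ 4 * (1 - r) / d ^ 3 * (ε * (2 * d) + M * (2 * d) ^ 3) := by
                refine mul_le_mul (norm_kernel_sub_reflected_le hζ1 hξ hr.1 hr.2)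
                  ((hb ζ hζ).trans ?_) (norm_nonneg _) (by positivity)
                gcongr
            _ = 8 * ε * ((1 - r) / d ^ 2) + 32 * M * (1 - r) := by
                field_simp; ring
            _ ≤ _ := by
                gcongr
                nlinarith [hr.1]
      _ = 8 * ε + 32 * M * (1 - r) := by
          rw [Real.circleAverage_fun_add, Real.circleAverage_fun_smul,
            circleAverage_inv_norm_sub_sq hz, Real.circleAverage_const, smul_eq_mul, mul_one]
          · exact cP'.circleIntegrable zero_le_one
          · exact circleIntegrable_const _ _ _
  rw [Metric.tendsto_nhds]
  intro ε hε
  obtain ⟨M, hM, hb⟩ := key (ε / 16) (by positivity)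
  have h1 : ∀ᶠ r : ℝ in 𝓝[<] 1, r ∈ Ioo (0 : ℝ) 1 :=
    Ioo_mem_nhdsLT zero_lt_one
  have h2 : Tendsto (fun r : ℝ => M * (1 - r)) (𝓝[<] 1) (𝓝 0) := by
    have : Tendsto (fun r : ℝ => M * (1 - r)) (𝓝 1) (𝓝 (M * (1 - 1))) :=
      (Continuous.tendsto (by fun_prop) 1)
    simp only [sub_self, mul_zero] at this
    exact this.mono_left nhdsWithin_le_nhds
  filter_upwards [h1, h2.eventually_lt_const (show (0 : ℝ) < ε / 2 by positivity)] with r hr hr2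
  rw [dist_eq_norm]
  linarith [hb r hr]

/-- Near the point, differentiability in the angle gives the `ε` term; away from it, the Lipschitz
bound is absorbed by the cubic term at the price of a large `M`. The complex slope is the angular
derivative divided by `iξ`, the velocity of the circle. -/
theorem circle_differentiability_bound {G : ℂ → ℂ} {K : NNReal} (hG : LipschitzWith K G) {θ : ℝ}
    (hd : DifferentiableAt ℝ (fun t => G (circleMap 0 1 t)) θ) :
    ∃ c : ℂ, ∀ ε > 0, ∃ M, 0 ≤ M ∧ ∀ w ∈ sphere (0 : ℂ) 1,
      ‖G w - G (circleMap 0 1 θ) - c * (w - circleMap 0 1 θ)‖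
        ≤ ε * ‖w - circleMap 0 1 θ‖ + M * ‖w - circleMap 0 1 θ‖ ^ 3 := by
  set ξ := circleMap 0 1 θ with hξdef
  have hξ : ‖ξ‖ = 1 := by simp [hξdef]
  have hξ0 : ξ ≠ 0 := norm_pos_iff.1 (by rw [hξ]; norm_num)
  set D := deriv (fun t => G (circleMap 0 1 t)) θ with hD
  set c := D / (Complex.I * ξ) with hc
  have hlip : ∀ w, ‖G w - G ξ - c * (w - ξ)‖ ≤ (K + ‖c‖) * ‖w - ξ‖ := by
    intro w
    refine (norm_sub_le _ _).trans ?_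
    rw [norm_mul, add_mul]
    gcongr
    simpa [dist_eq_norm] using hG.dist_le_mul w ξ
  refine ⟨c, fun ε hε => ?_⟩
  have ho := hd.hasDerivAt.hasDerivWithinAt (s := univ)
  rw [hasDerivWithinAt_univ, hasDerivAt_iff_isLittleO_nhds_zero] at ho
  -- The near-point error is `2η|τ|`, and `|τ| ≤ (π/2)|w - ξ|` turns it into `ε(π/4)|w - ξ|`, which
  -- suffices since `π < 4`.
  set η := ε / 4 with hη
  have hηpos : 0 < η := by positivity
  have ho2 := ho.bound hηpos
  rw [Metric.eventually_nhds_iff] at ho2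
  obtain ⟨δ₀, hδ₀, hδb⟩ := ho2
  -- The three bounds serve, in order, the little-o estimate, the second-order bound for `exp`, and
  -- the absorption of `‖D‖ |τ|²` into `η|τ|`.
  set δ := min δ₀ (min 1 (η / (‖D‖ + 1))) with hδdef
  have hδ : 0 < δ := by positivity
  refine ⟨(K + ‖c‖) * (Real.pi / 2 / δ) ^ 2, by positivity, fun w hw => ?_⟩
  have hw1 : ‖w‖ = 1 := by simpa using hw
  have hw0 : w ≠ 0 := norm_pos_iff.1 (by rw [hw1]; norm_num)
  set τ := (w / ξ).arg with hτ
  have hτw : |τ| ≤ Real.pi / 2 * ‖w - ξ‖ := by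
    rw [hτ, ← Complex.angle_eq_abs_arg hw0 hξ0]
    exact Complex.angle_le_mul_norm_sub hw1 hξ
  have hwτ : w = ξ * Complex.exp (τ * Complex.I) := by
    have := Complex.norm_mul_exp_arg_mul_I (w / ξ)
    rw [norm_div, hw1, hξ, div_one, Complex.ofReal_one, one_mul] at this
    rw [hτ, this]; field_simp
  have hwc : w = circleMap 0 1 (θ + τ) := by
    rw [hwτ, hξdef]
    simp only [circleMap, Complex.ofReal_one, one_mul, zero_add, ← Complex.exp_add]
    push_cast; ring_nf
  rcases lt_or_ge |τ| δ with hlt | hge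
  · have h1 : ‖G w - G ξ - τ • D‖ ≤ η * |τ| := by
      have := hδb (y := τ) (by simpa using hlt.trans_le (min_le_left _ _))
      rw [← hwc] at this
      simpa using this
    have h2 : ‖Complex.exp (τ * Complex.I) - 1 - τ * Complex.I‖ ≤ |τ| ^ 2 := by
      have hn : ‖(τ * Complex.I : ℂ)‖ = |τ| := by simp
      rw [← hn]
      apply Complex.norm_exp_sub_one_sub_id_le
      rw [hn]
      exact (hlt.trans_le ((min_le_right _ _).trans (min_le_left _ _))).le
    have h3 : G w - G ξ - c * (w - ξ) = (G w - G ξ - τ • D)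
        - D / Complex.I * (Complex.exp (τ * Complex.I) - 1 - τ * Complex.I) := by
      have : w - ξ = ξ * (Complex.exp (τ * Complex.I) - 1) := by
        conv_lhs => rw [hwτ]
        ring
      rw [this, hc, Complex.real_smul]
      field_simp
      ring
    have h4 : ‖D‖ * |τ| ≤ η := by
      have : |τ| ≤ η / (‖D‖ + 1) :=
        (hlt.trans_le ((min_le_right _ _).trans (min_le_right _ _))).le
      rw [le_div_iff₀ (by positivity)] at this
      nlinarith [abs_nonneg τ]
    have h5 : ‖G w - G ξ - c * (w - ξ)‖ ≤ 2 * η * |τ| := by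
      rw [h3]
      refine (norm_sub_le _ _).trans ?_
      rw [norm_mul, norm_div, Complex.norm_I, div_one]
      have := mul_le_mul_of_nonneg_left h2 (norm_nonneg D)
      nlinarith [abs_nonneg τ, mul_le_mul_of_nonneg_right h4 (abs_nonneg τ)]
    have h6 : 2 * η * |τ| ≤ ε * ‖w - ξ‖ := by
      have hpi := Real.pi_lt_four
      calc 2 * η * |τ| ≤ 2 * η * (Real.pi / 2 * ‖w - ξ‖) := by gcongr
        _ = ε * (Real.pi / 4) * ‖w - ξ‖ := by rw [hη]; ring
        _ ≤ ε * 1 * ‖w - ξ‖ := by gcongr; linarith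
        _ = _ := by ring
    have : 0 ≤ (K + ‖c‖) * (Real.pi / 2 / δ) ^ 2 * ‖w - ξ‖ ^ 3 := by positivity
    linarith
  · have h1 : 1 ≤ Real.pi / 2 / δ * ‖w - ξ‖ := by
      rw [div_mul_eq_mul_div, one_le_div hδ]
      linarith
    calc _ ≤ (K + ‖c‖) * ‖w - ξ‖ * 1 := by rw [mul_one]; exact hlip w
      _ ≤ (K + ‖c‖) * ‖w - ξ‖ * (Real.pi / 2 / δ * ‖w - ξ‖) ^ 2 := by
        gcongr
        exact one_le_pow₀ h1
      _ = (K + ‖c‖) * (Real.pi / 2 / δ) ^ 2 * ‖w - ξ‖ ^ 3 := by ring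
      _ ≤ _ := by
        have : 0 ≤ ε * ‖w - ξ‖ := by positivity
        linarith

/-- **Fatou's theorem** for bounded analytic functions: radial limits exist almost everywhere. -/
theorem ae_exists_radial_limit {h : ℂ → ℂ} (hd : DifferentiableOn ℂ h (ball 0 1)) {M : ℝ}
    (hM : ∀ z ∈ ball (0 : ℂ) 1, ‖h z‖ ≤ M) :
    ∀ᵐ θ : ℝ, ∃ c, Tendsto (fun r : ℝ => h (r * circleMap 0 1 θ)) (𝓝[<] 1) (𝓝 c) := by
  obtain ⟨H, hH⟩ := hd.isExactOn_ball
  have hM' : ∀ z ∈ ball (0 : ℂ) 1, ‖h z‖₊ ≤ M.toNNReal := fun z hz => by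
    rw [← NNReal.coe_le_coe, coe_nnnorm]
    exact (hM z hz).trans (Real.le_coe_toNNReal M)
  -- A bounded function has a Lipschitz primitive on the convex disc. Its Lipschitz extension to the
  -- plane supplies the boundary values whose angular derivative exists almost everywhere.
  have hlip := (convex_ball (0 : ℂ) 1).lipschitzOnWith_of_nnnorm_hasDerivWithin_le
    (fun z hz => (hH z hz).hasDerivWithinAt) hM'
  obtain ⟨G, hG, hGH⟩ := hlip.extend_finite_dimension
  have hGd : ∀ z ∈ ball (0 : ℂ) 1, HasDerivAt G (h z) z := fun z hz =>
    (hH z hz).congr_of_eventuallyEq ((hGH.eventuallyEq_of_mem (isOpen_ball.mem_nhds hz)).symm)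
  have hGc : DiffContOnCl ℂ G (ball 0 1) :=
    ⟨fun z hz => (hGd z hz).differentiableAt.differentiableWithinAt, hG.continuous.continuousOn⟩
  filter_upwards [(hG.comp (lipschitzWith_circleMap 0 1)).ae_differentiableAt] with θ hθ
  obtain ⟨c, hc⟩ := circle_differentiability_bound hG hθ
  refine ⟨c, (tendsto_deriv_radial hGc (by simp) hc).congr' ?_⟩
  filter_upwards [Ioo_mem_nhdsLT zero_lt_one] with r hr
  refine (hGd _ ?_).deriv
  rw [mem_ball_zero_iff, norm_mul, Complex.norm_real, Real.norm_of_nonneg hr.1.le]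
  simpa using hr.2

/-! ### Integrals along chords -/

/-- The length of the arc cut off by the chord from `1` to `e^{iθ}` that does not contain
`e^{iψ}`. -/
noncomputable def oppositeArc (θ ψ : ℝ) : ℝ := if θ < ψ then θ else 2 * Real.pi - θ

/-- The integrand is the derivative of `Im log(1 + ts) / Im s`; since `Im s ≠ 0`, the segment never
meets the branch cut. -/
theorem integral_inv_normSq_one_add_mul {s : ℂ} (hs : s.im ≠ 0) :
    ∫ t in (0 : ℝ)..1, (Complex.normSq (1 + t * s))⁻¹ = (1 + s).arg / s.im := by
  have hslit : ∀ t : ℝ, 1 + t * s ∈ Complex.slitPlane := by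
    intro t
    rcases eq_or_ne t 0 with rfl | ht
    · simp
    · right
      simp [ht, hs]
  have hne : ∀ t : ℝ, 1 + t * s ≠ 0 := fun t => Complex.slitPlane_ne_zero (hslit t)
  have hd : ∀ t : ℝ, HasDerivAt (fun t : ℝ => (Complex.log (1 + t * s)).im / s.im)
      ((Complex.normSq (1 + t * s))⁻¹) t := by
    intro t
    have h1 : HasDerivAt (fun t : ℝ => (1 + t * s : ℂ)) s t := by
      simpa using ((hasDerivAt_id t).ofReal_comp.mul_const s).const_add 1
    have h2 := (Complex.imCLM.hasFDerivAt.comp_hasDerivAt t (h1.clog_real (hslit t))).div_const s.im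
    refine h2.congr_deriv ?_
    have h3 : Complex.normSq (1 + t * s) ≠ 0 := mt Complex.normSq_eq_zero.1 (hne t)
    simp only [Complex.imCLM_apply, Complex.div_im]
    field_simp
    simp
    ring
  rw [intervalIntegral.integral_eq_sub_of_hasDerivAt (fun t _ => hd t)]
  · simp [Complex.log_im]
  · apply Continuous.intervalIntegrable
    refine Continuous.inv₀ (by fun_prop) fun t => mt Complex.normSq_eq_zero.1 (hne t)

theorem circleMap_half_sq (θ : ℝ) : circleMap 0 1 θ = circleMap 0 1 (θ / 2) ^ 2 := by
  simp only [circleMap, Complex.ofReal_one, one_mul, zero_add, ← Complex.exp_nat_mul]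
  congr 1
  push_cast
  ring

theorem circleMap_sub_one (θ : ℝ) : circleMap 0 1 θ - 1
    = 2 * Complex.I * Complex.sin ((θ / 2 : ℝ) : ℂ) * circleMap 0 1 (θ / 2) := by
  rw [circleMap_half_sq]
  have h := Complex.exp_ne_zero (((θ / 2 : ℝ) : ℂ) * Complex.I)
  simp only [circleMap, Complex.ofReal_one, one_mul, zero_add, Complex.sin, neg_mul,
    Complex.exp_neg]
  field_simp
  ring_nf
  simp

theorem norm_circleMap_sub_one {θ : ℝ} (hθ : θ ∈ Ioo 0 (2 * Real.pi)) :
    ‖circleMap 0 1 θ - 1‖ = 2 * Real.sin (θ / 2) := by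
  have hs : 0 < Real.sin (θ / 2) :=
    Real.sin_pos_of_pos_of_lt_pi (by linarith [hθ.1]) (by linarith [hθ.2])
  rw [circleMap_sub_one, norm_mul, norm_mul, norm_mul, ← Complex.ofReal_sin, Complex.norm_real,
    Real.norm_of_nonneg hs.le]
  simp

theorem circleMap_sub_mul_sin (θ ψ : ℝ) :
    (circleMap 0 1 θ - circleMap 0 1 ψ) * Complex.sin ((ψ / 2 : ℝ) : ℂ)
      = (1 - circleMap 0 1 ψ) * circleMap 0 1 (θ / 2) * Complex.sin (((ψ - θ) / 2 : ℝ) : ℂ) := by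
  rw [circleMap_half_sq θ, circleMap_half_sq ψ]
  have hx := Complex.exp_ne_zero (((ψ / 2 : ℝ) : ℂ) * Complex.I)
  have hy := Complex.exp_ne_zero (((θ / 2 : ℝ) : ℂ) * Complex.I)
  have e1 : Complex.exp ((((ψ - θ) / 2 : ℝ) : ℂ) * Complex.I)
      = Complex.exp (((ψ / 2 : ℝ) : ℂ) * Complex.I)
        / Complex.exp (((θ / 2 : ℝ) : ℂ) * Complex.I) := by
    rw [← Complex.exp_sub]; congr 1; push_cast; ring
  simp only [circleMap, Complex.ofReal_one, one_mul, zero_add, Complex.sin, neg_mul,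
    Complex.exp_neg, e1]
  field_simp

/-- Dividing by `1 - ζ` turns the chord into the segment from `1` to `1 + s = (b - ζ)/(1 - ζ)`, and
the integral becomes `|b - 1| α / sin α` with `α = arg (1 + s)`. This `α` is the signed inscribed
angle at `ζ`, so `2|α|` is the arc not containing `ζ`, while `|b - 1| = 2 |sin α|`. -/
theorem integral_chord_kernel {θ ψ : ℝ} (hθ : θ ∈ Ioo 0 (2 * Real.pi))
    (hψ : ψ ∈ Ioo 0 (2 * Real.pi)) (hne : θ ≠ ψ) :
    ∫ t in (0 : ℝ)..1, ‖circleMap 0 1 ψ - 1‖ * ‖circleMap 0 1 ψ - circleMap 0 1 θ‖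
        / ‖circleMap 0 1 ψ - (1 + t * (circleMap 0 1 θ - 1))‖ ^ 2 * ‖circleMap 0 1 θ - 1‖
      = oppositeArc θ ψ := by
  have hnb := norm_circleMap_sub_one hθ
  have hnz := norm_circleMap_sub_one hψ
  have hid := circleMap_sub_mul_sin θ ψ
  have hsθ : 0 < Real.sin (θ / 2) :=
    Real.sin_pos_of_pos_of_lt_pi (by linarith [hθ.1]) (by linarith [hθ.2])
  have hsψ : 0 < Real.sin (ψ / 2) :=
    Real.sin_pos_of_pos_of_lt_pi (by linarith [hψ.1]) (by linarith [hψ.2])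
  set b := circleMap 0 1 θ with hb
  set ζ := circleMap 0 1 ψ with hζ
  have hz1 : 1 - ζ ≠ 0 := by
    rw [← norm_pos_iff, norm_sub_rev, hnz]; positivity
  set s := (b - 1) / (1 - ζ) with hs
  have h1s : 1 + s = (b - ζ) / (1 - ζ) := by rw [hs]; field_simp; ring
  obtain ⟨l, α, hl, hα, he, hopp⟩ : ∃ l α : ℝ, 0 < l ∧ (α ∈ Ioc (-Real.pi) Real.pi) ∧
      1 + s = l * (Complex.cos α + Complex.sin α * Complex.I) ∧
      (Real.sin α ≠ 0 ∧ 2 * Real.sin (θ / 2) * (α / Real.sin α) = oppositeArc θ ψ) := by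
    have hc : circleMap 0 1 (θ / 2)
        = Complex.cos ((θ / 2 : ℝ) : ℂ) + Complex.sin ((θ / 2 : ℝ) : ℂ) * Complex.I := by
      simp only [circleMap, Complex.ofReal_one, one_mul, zero_add, Complex.exp_mul_I]
    have hsc : Complex.sin ((ψ / 2 : ℝ) : ℂ) ≠ 0 := by
      rw [← Complex.ofReal_sin]; exact_mod_cast hsψ.ne'
    have h1s' : 1 + s = ((Real.sin ((ψ - θ) / 2) / Real.sin (ψ / 2) : ℝ) : ℂ)
        * circleMap 0 1 (θ / 2) := by
      rw [h1s, Complex.ofReal_div, Complex.ofReal_sin, Complex.ofReal_sin, div_mul_eq_mul_div,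
        div_eq_div_iff hz1 hsc]
      linear_combination hid
    rcases lt_or_gt_of_ne hne with hlt | hgt
    · refine ⟨_, θ / 2, ?_, ⟨by linarith [hθ.1, Real.pi_pos], by linarith [hθ.2]⟩,
        by rw [h1s', hc], hsθ.ne', ?_⟩
      · refine div_pos (Real.sin_pos_of_pos_of_lt_pi (by linarith) ?_) hsψ
        linarith [hψ.2, hθ.1]
      · rw [oppositeArc, if_pos hlt]; field_simp
    -- Here the real factor in front of `e^{iθ/2}` is negative; moving its sign into the angle gives
    -- the principal argument `θ/2 - π`.
    · refine ⟨Real.sin ((θ - ψ) / 2) / Real.sin (ψ / 2), θ / 2 - Real.pi, ?_,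
        ⟨by linarith [hθ.1, Real.pi_pos], by linarith [hθ.2, Real.pi_pos]⟩, ?_, ?_, ?_⟩
      · refine div_pos (Real.sin_pos_of_pos_of_lt_pi (by linarith) ?_) hsψ
        linarith [hψ.1, hθ.2]
      · rw [h1s', hc, ← Complex.ofReal_cos, ← Complex.ofReal_sin, ← Complex.ofReal_cos,
          ← Complex.ofReal_sin, Real.cos_sub_pi, Real.sin_sub_pi,
          show (ψ - θ) / 2 = -((θ - ψ) / 2) by ring, Real.sin_neg]
        push_cast
        ring
      · rw [Real.sin_sub_pi]; exact neg_ne_zero.2 hsθ.ne'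
      · rw [oppositeArc, if_neg hgt.le.not_gt, Real.sin_sub_pi]; field_simp; ring
  have him : s.im = l * Real.sin α := by
    have := congrArg Complex.im he
    rw [Complex.im_ofReal_mul, ← Complex.ofReal_cos, ← Complex.ofReal_sin] at this
    simpa [Complex.sin_ofReal_re] using this
  have hn1s : ‖1 + s‖ = l := by
    rw [he, ← Complex.exp_mul_I, norm_mul, Complex.norm_exp_ofReal_mul_I, Complex.norm_real,
      Real.norm_of_nonneg hl.le, mul_one]
  have harg : (1 + s).arg = α := by
    rw [he]; exact Complex.arg_mul_cos_add_sin_mul_I hl hα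
  have hint : ∀ t : ℝ, ‖ζ - 1‖ * ‖ζ - b‖ / ‖ζ - (1 + t * (b - 1))‖ ^ 2 * ‖b - 1‖
      = ‖1 + s‖ * ‖b - 1‖ * (Complex.normSq (1 + t * s))⁻¹ := by
    intro t
    have e1 : ζ - (1 + t * (b - 1)) = -((1 - ζ) * (1 + t * s)) := by rw [hs]; field_simp; ring
    have hp : ‖1 - ζ‖ ≠ 0 := norm_ne_zero_iff.2 hz1
    rw [e1, norm_neg, norm_mul, h1s, norm_div, Complex.normSq_eq_norm_sq, norm_sub_rev ζ 1,
      norm_sub_rev ζ b, mul_pow]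
    field_simp
  simp only [hint]
  rw [intervalIntegral.integral_const_mul, integral_inv_normSq_one_add_mul
    (by rw [him]; exact mul_ne_zero hl.ne' hopp.1), harg, him, hn1s, hnb, ← hopp.2]
  have := hopp.1
  field_simp

theorem one_sub_norm_sq_chord {a b : ℂ} (ha : ‖a‖ = 1) (hb : ‖b‖ = 1) (t : ℝ) :
    1 - ‖a + t * (b - a)‖ ^ 2 = t * (1 - t) * ‖b - a‖ ^ 2 := by
  rw [← Complex.normSq_eq_norm_sq, ← Complex.normSq_eq_norm_sq]
  have h1 : a.re * a.re + a.im * a.im = 1 := by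
    rw [← Complex.normSq_apply, Complex.normSq_eq_norm_sq, ha]; norm_num
  have h2 : b.re * b.re + b.im * b.im = 1 := by
    rw [← Complex.normSq_apply, Complex.normSq_eq_norm_sq, hb]; norm_num
  simp only [Complex.normSq_apply, Complex.add_re, Complex.add_im, Complex.sub_re, Complex.sub_im,
    Complex.re_ofReal_mul, Complex.im_ofReal_mul]
  linear_combination (t - 1) * h1 - t * h2

/-- Apply the Poisson formula to `(ζ - a)(ζ - b) g(ζ)`: at a point `w` of the chord its modulus is
`(1 - |w|²)|g(w)|`, and the factor `1 - |w|²` cancels against the Poisson kernel. -/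
theorem norm_le_circleAverage_chord {g : ℂ → ℂ} (hg : DiffContOnCl ℂ g (ball 0 1)) {a b : ℂ}
    (ha : ‖a‖ = 1) (hb : ‖b‖ = 1) (hab : a ≠ b) {t : ℝ} (ht : t ∈ Ioo (0 : ℝ) 1) :
    ‖g (a + t * (b - a))‖ ≤ Real.circleAverage
      (fun ζ => ‖g ζ‖ * (‖ζ - a‖ * ‖ζ - b‖ / ‖ζ - (a + t * (b - a))‖ ^ 2)) 0 1 := by
  have hw2 := one_sub_norm_sq_chord ha hb t
  set w := a + t * (b - a) with hwdef
  have hba : 0 < ‖b - a‖ := norm_pos_iff.2 (sub_ne_zero.2 hab.symm)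
  have ht1 : 0 < 1 - t := by linarith [ht.2]
  have hpos : 0 < 1 - ‖w‖ ^ 2 := by
    rw [hw2]
    have := ht.1
    positivity
  have hw : w ∈ ball (0 : ℂ) 1 := by
    rw [mem_ball_zero_iff]
    nlinarith [norm_nonneg w]
  have hwa : ‖w - a‖ = t * ‖b - a‖ := by
    rw [hwdef, add_sub_cancel_left, norm_mul, Complex.norm_real, Real.norm_of_nonneg ht.1.le]
  have hwb : ‖w - b‖ = (1 - t) * ‖b - a‖ := by
    have : w - b = -(((1 - t : ℝ) : ℂ) * (b - a)) := by rw [hwdef]; push_cast; ring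
    rw [this, norm_neg, norm_mul, Complex.norm_real, Real.norm_of_nonneg ht1.le]
  have hprod : ‖w - a‖ * ‖w - b‖ = 1 - ‖w‖ ^ 2 := by rw [hwa, hwb, hw2]; ring
  have hF : DiffContOnCl ℂ (fun z => ((z - a) * (z - b)) • g z) (ball 0 1) :=
    (Differentiable.diffContOnCl (by fun_prop)).smul hg
  have hP := DiffContOnCl.circleAverage_poissonKernel_smul' hF hw
  have hnorm := norm_circleAverage_le (fun z => ((‖z - 0‖ ^ 2 - ‖w - 0‖ ^ 2)
    / ‖(z - 0) - (w - 0)‖ ^ 2) • ((z - a) * (z - b)) • g z) 0 1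
  rw [hP, norm_smul, norm_mul, hprod] at hnorm
  have heq : Real.circleAverage (fun z => ‖((‖z - 0‖ ^ 2 - ‖w - 0‖ ^ 2)
      / ‖(z - 0) - (w - 0)‖ ^ 2) • ((z - a) * (z - b)) • g z‖) 0 1
      = (1 - ‖w‖ ^ 2) * Real.circleAverage
        (fun ζ => ‖g ζ‖ * (‖ζ - a‖ * ‖ζ - b‖ / ‖ζ - w‖ ^ 2)) 0 1 := by
    rw [← smul_eq_mul, ← Real.circleAverage_fun_smul]
    refine Real.circleAverage_congr_sphere fun ζ hζ => ?_
    have h1 : ‖ζ‖ = 1 := by simpa using hζ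
    simp only [sub_zero, norm_smul, norm_mul, smul_eq_mul, h1, one_pow]
    rw [Real.norm_of_nonneg (by positivity)]
    ring
  rw [heq] at hnorm
  exact le_of_mul_le_mul_left hnorm hpos

theorem measurable_oppositeArc : Measurable (Function.uncurry oppositeArc) := by
  refine Measurable.ite (measurableSet_lt measurable_fst measurable_snd) measurable_fst ?_
  fun_prop

theorem oppositeArc_mem_Icc {θ ψ : ℝ} (hθ : θ ∈ Icc 0 (2 * Real.pi)) :
    oppositeArc θ ψ ∈ Icc 0 (2 * Real.pi) := by
  unfold oppositeArc
  split_ifs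
  · exact hθ
  · exact ⟨by linarith [hθ.2], by linarith [hθ.1]⟩

theorem continuous_comp_circleMap {g : ℂ → ℂ} (hg : DiffContOnCl ℂ g (ball 0 1)) :
    Continuous fun ψ : ℝ => g (circleMap 0 1 ψ) :=
  (continuousOn_sphere_of_diffContOnCl hg).comp_continuous (continuous_circleMap 0 1)
    fun ψ => circleMap_mem_sphere 0 zero_le_one ψ

theorem add_smul_sub_mem_closedBall {a b : ℂ} (ha : ‖a‖ ≤ 1) (hb : ‖b‖ ≤ 1) {t : ℝ}
    (ht : t ∈ Icc (0 : ℝ) 1) : a + t * (b - a) ∈ closedBall (0 : ℂ) 1 := by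
  have := (convex_closedBall (0 : ℂ) 1).add_smul_sub_mem (x := a) (y := b) (by simpa) (by simpa) ht
  simpa using this

theorem continuousOn_chord {g : ℂ → ℂ} (hg : ContinuousOn g (closedBall 0 1)) {a b : ℂ}
    (ha : ‖a‖ ≤ 1) (hb : ‖b‖ ≤ 1) :
    ContinuousOn (fun t : ℝ => g (a + t * (b - a))) (Icc 0 1) :=
  hg.comp (by fun_prop) fun _ ht => add_smul_sub_mem_closedBall ha hb ht

/-- The integral of `‖g‖` over the chord from `1` to `e^{iθ}` is bounded by the mean of `‖g‖`
over the circle, weighted by the opposite arc. -/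
theorem integral_chord_le {g : ℂ → ℂ} (hg : DiffContOnCl ℂ g (ball 0 1)) {θ : ℝ}
    (hθ : θ ∈ Ioo 0 (2 * Real.pi)) :
    ∫ t in (0 : ℝ)..1, ‖g (1 + t * (circleMap 0 1 θ - 1))‖ * ‖circleMap 0 1 θ - 1‖
      ≤ (2 * Real.pi)⁻¹ * ∫ ψ in (0 : ℝ)..2 * Real.pi,
        ‖g (circleMap 0 1 ψ)‖ * oppositeArc θ ψ := by
  have hpi := Real.pi_pos
  have hN := continuous_comp_circleMap hg
  set b := circleMap 0 1 θ with hb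
  have hb1 : ‖b‖ = 1 := by simp [hb]
  have hb0 : (1 : ℂ) ≠ b := by
    intro h
    have := norm_circleMap_sub_one hθ
    rw [← hb, ← h, sub_self, norm_zero] at this
    have hs : 0 < Real.sin (θ / 2) :=
      Real.sin_pos_of_pos_of_lt_pi (by linarith [hθ.1]) (by linarith [hθ.2])
    linarith
  let ker : ℝ → ℝ → ℝ := fun t ψ => ‖circleMap 0 1 ψ - 1‖ * ‖circleMap 0 1 ψ - b‖
    / ‖circleMap 0 1 ψ - (1 + t * (b - 1))‖ ^ 2 * ‖b - 1‖
  have hker0 : ∀ t ψ, 0 ≤ ker t ψ := fun t ψ => by positivity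
  have hkerm : Measurable (Function.uncurry ker) := by
    simp only [ker, Function.uncurry_def]
    fun_prop
  have hpt : ∀ t ∈ Ioo (0 : ℝ) 1, ENNReal.ofReal (‖g (1 + t * (b - 1))‖ * ‖b - 1‖)
      ≤ ∫⁻ ψ in Ioc 0 (2 * Real.pi),
        ENNReal.ofReal ((2 * Real.pi)⁻¹ * ‖g (circleMap 0 1 ψ)‖) * ENNReal.ofReal (ker t ψ) := by
    intro t ht
    have h1 := norm_le_circleAverage_chord hg norm_one hb1 hb0 ht
    have hw : ∀ ψ, circleMap 0 1 ψ - (1 + t * (b - 1)) ≠ 0 := by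
      intro ψ h0
      have h2 := one_sub_norm_sq_chord norm_one hb1 t
      rw [← sub_eq_zero.1 h0] at h2
      simp only [norm_circleMap_zero, abs_one, one_pow, sub_self] at h2
      have : 0 < ‖b - 1‖ := norm_pos_iff.2 (sub_ne_zero.2 hb0.symm)
      have h3 : 0 < 1 - t := by linarith [ht.2]
      have := ht.1
      have : 0 < t * (1 - t) * ‖b - 1‖ ^ 2 := by positivity
      linarith
    have hcont : Continuous fun ψ => (2 * Real.pi)⁻¹ * ‖g (circleMap 0 1 ψ)‖ * ker t ψ := by
      refine (continuous_const.mul hN.norm).mul (Continuous.mul (Continuous.div ?_ ?_ ?_) ?_)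
      · fun_prop
      · fun_prop
      · exact fun ψ => pow_ne_zero 2 (norm_ne_zero_iff.2 (hw ψ))
      · fun_prop
    have h4 : ‖g (1 + t * (b - 1))‖ * ‖b - 1‖ ≤ ∫ ψ in Ioc 0 (2 * Real.pi),
        (2 * Real.pi)⁻¹ * ‖g (circleMap 0 1 ψ)‖ * ker t ψ := by
      refine (mul_le_mul_of_nonneg_right h1 (norm_nonneg _)).trans_eq ?_
      rw [Real.circleAverage_def, ← intervalIntegral.integral_of_le (by positivity), smul_eq_mul,
        mul_assoc, ← intervalIntegral.integral_mul_const, ← intervalIntegral.integral_const_mul]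
      congr 1
      ext ψ
      simp only [ker]
      ring
    refine (ENNReal.ofReal_le_ofReal h4).trans_eq ?_
    rw [ofReal_integral_eq_lintegral_ofReal]
    · refine lintegral_congr fun ψ => ?_
      rw [ENNReal.ofReal_mul (by positivity)]
    · exact (hcont.integrableOn_Icc).mono_set Ioc_subset_Icc_self
    · exact ae_of_all _ fun ψ => by have := hker0 t ψ; positivity
  have hNm : Measurable fun ψ : ℝ => ENNReal.ofReal ((2 * Real.pi)⁻¹ * ‖g (circleMap 0 1 ψ)‖) :=
    (continuous_const.mul hN.norm).measurable.ennreal_ofReal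
  -- Tonelli for nonnegative integrands lets the kernel be integrated over the chord first, with no
  -- joint integrability to check.
  have hmain : ∫⁻ t in Ioo (0 : ℝ) 1, ENNReal.ofReal (‖g (1 + t * (b - 1))‖ * ‖b - 1‖)
      ≤ ∫⁻ ψ in Ioc 0 (2 * Real.pi),
        ENNReal.ofReal ((2 * Real.pi)⁻¹ * (‖g (circleMap 0 1 ψ)‖ * oppositeArc θ ψ)) := by
    calc _ ≤ ∫⁻ t in Ioo (0 : ℝ) 1, ∫⁻ ψ in Ioc 0 (2 * Real.pi),
          ENNReal.ofReal ((2 * Real.pi)⁻¹ * ‖g (circleMap 0 1 ψ)‖) * ENNReal.ofReal (ker t ψ) :=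
          setLIntegral_mono' measurableSet_Ioo hpt
      _ = ∫⁻ ψ in Ioc 0 (2 * Real.pi), ∫⁻ t in Ioo (0 : ℝ) 1,
          ENNReal.ofReal ((2 * Real.pi)⁻¹ * ‖g (circleMap 0 1 ψ)‖) * ENNReal.ofReal (ker t ψ) := by
          refine lintegral_lintegral_swap ?_
          exact ((hNm.comp measurable_snd).mul hkerm.ennreal_ofReal).aemeasurable
      _ = _ := by
          refine lintegral_congr_ae ?_
          have hae : ∀ᵐ ψ ∂(volume.restrict (Ioc 0 (2 * Real.pi))),
              ψ ∈ Ioo 0 (2 * Real.pi) ∧ θ ≠ ψ := by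
            have h1 : ∀ᵐ ψ : ℝ, ψ ≠ 2 * Real.pi ∧ ψ ≠ θ := by
              filter_upwards [Measure.ae_ne volume (2 * Real.pi), Measure.ae_ne volume θ] with x
                hx hy using ⟨hx, hy⟩
            filter_upwards [ae_restrict_mem measurableSet_Ioc, ae_restrict_of_ae h1] with ψ h2 h3
            exact ⟨⟨h2.1, lt_of_le_of_ne h2.2 h3.1⟩, h3.2.symm⟩
          filter_upwards [hae] with ψ hψ
          have hkt : Measurable fun t => ENNReal.ofReal (ker t ψ) :=
            (hkerm.comp (measurable_id.prodMk measurable_const)).ennreal_ofReal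
          rw [lintegral_const_mul _ hkt, ← mul_assoc, ENNReal.ofReal_mul (p := _ * _) (by positivity)]
          congr 1
          have hval : ∫ t in (0 : ℝ)..1, ker t ψ = oppositeArc θ ψ :=
            integral_chord_kernel hθ hψ.1 hψ.2
          have harc : 0 < oppositeArc θ ψ := by
            unfold oppositeArc
            split_ifs
            · exact hθ.1
            · linarith [hθ.2]
          -- A non-integrable function would have integral `0` by convention, but the computed value
          -- is positive.
          have hint : IntervalIntegrable (fun t => ker t ψ) volume 0 1 := by
            by_contra hcon
            rw [intervalIntegral.integral_undef hcon] at hval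
            linarith
          rw [← hval, intervalIntegral.integral_of_le zero_le_one, integral_Ioc_eq_integral_Ioo,
            ofReal_integral_eq_lintegral_ofReal]
          · exact (intervalIntegrable_iff_integrableOn_Ioo_of_le zero_le_one).1 hint
          · exact ae_of_all _ fun t => hker0 t ψ
  have hL : IntegrableOn (fun t : ℝ => ‖g (1 + t * (b - 1))‖ * ‖b - 1‖) (Ioo 0 1) :=
    (((continuousOn_chord hg.continuousOn_ball norm_one.le hb1.le).norm.mul
      continuousOn_const).integrableOn_Icc).mono_set Ioo_subset_Icc_self
  have harc := fun ψ => oppositeArc_mem_Icc (ψ := ψ) ⟨hθ.1.le, hθ.2.le⟩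
  have hR : IntegrableOn (fun ψ => (2 * Real.pi)⁻¹ * (‖g (circleMap 0 1 ψ)‖ * oppositeArc θ ψ))
      (Ioc 0 (2 * Real.pi)) := by
    refine Integrable.const_mul (Integrable.mul_bdd (c := 2 * Real.pi) ?_ ?_ ?_) _
    · exact (hN.norm.integrableOn_Icc).mono_set Ioc_subset_Icc_self
    · exact (measurable_oppositeArc.comp (measurable_const.prodMk measurable_id)).aestronglyMeasurable
    · exact ae_of_all _ fun ψ => by
        rw [Real.norm_of_nonneg (harc ψ).1]
        exact (harc ψ).2
  have hR0 : ∀ ψ, 0 ≤ (2 * Real.pi)⁻¹ * (‖g (circleMap 0 1 ψ)‖ * oppositeArc θ ψ) := fun ψ => by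
    have := (harc ψ).1
    positivity
  rw [← intervalIntegral.integral_const_mul, intervalIntegral.integral_of_le zero_le_one,
    intervalIntegral.integral_of_le (by positivity), integral_Ioc_eq_integral_Ioo,
    ← ENNReal.ofReal_le_ofReal_iff (integral_nonneg hR0),
    ofReal_integral_eq_lintegral_ofReal hL (ae_of_all _ fun t => by positivity),
    ofReal_integral_eq_lintegral_ofReal hR (ae_of_all _ hR0)]
  exact hmain

/-- The exact value is `ψ²/2 + (2π - ψ)²/2`, which falls short of `2π²` by `ψ(2π - ψ)`. -/
theorem integral_oppositeArc_le {ψ : ℝ} (hψ : ψ ∈ Icc 0 (2 * Real.pi)) :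
    ∫ θ in (0 : ℝ)..2 * Real.pi, oppositeArc θ ψ ≤ 2 * Real.pi ^ 2 := by
  have hc1 : EqOn (fun θ => oppositeArc θ ψ) (fun θ => θ) (Ioo 0 ψ) := fun θ hθ => if_pos hθ.2
  have hc2 : EqOn (fun θ => oppositeArc θ ψ) (fun θ => 2 * Real.pi - θ) (Ioo ψ (2 * Real.pi)) :=
    fun θ hθ => if_neg hθ.1.not_gt
  have hm : Measurable fun θ => oppositeArc θ ψ :=
    measurable_oppositeArc.comp (measurable_id.prodMk measurable_const)
  have hint : ∀ a ∈ Icc 0 (2 * Real.pi), ∀ c ∈ Icc 0 (2 * Real.pi),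
      IntervalIntegrable (fun θ => oppositeArc θ ψ) volume a c := by
    intro a ha c hc
    rw [intervalIntegrable_iff]
    refine Measure.integrableOn_of_bounded (M := 2 * Real.pi) (by simp) hm.aestronglyMeasurable ?_
    filter_upwards [ae_restrict_mem measurableSet_uIoc] with θ hθ
    have hθ' : θ ∈ Icc 0 (2 * Real.pi) :=
      (uIoc_subset_uIcc.trans (uIcc_subset_Icc ha hc)) hθ
    have := oppositeArc_mem_Icc (ψ := ψ) hθ'
    rw [Real.norm_of_nonneg this.1]
    exact this.2
  have h0 : (0 : ℝ) ∈ Icc 0 (2 * Real.pi) := ⟨le_rfl, by positivity⟩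
  have h2 : 2 * Real.pi ∈ Icc 0 (2 * Real.pi) := ⟨by positivity, le_rfl⟩
  rw [← intervalIntegral.integral_add_adjacent_intervals (hint 0 h0 ψ hψ) (hint ψ hψ _ h2),
    intervalIntegral.integral_of_le hψ.1, intervalIntegral.integral_of_le hψ.2,
    integral_Ioc_eq_integral_Ioo, integral_Ioc_eq_integral_Ioo,
    setIntegral_congr_fun measurableSet_Ioo hc1, setIntegral_congr_fun measurableSet_Ioo hc2,
    ← integral_Ioc_eq_integral_Ioo, ← integral_Ioc_eq_integral_Ioo,
    ← intervalIntegral.integral_of_le hψ.1, ← intervalIntegral.integral_of_le hψ.2,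
    integral_id, intervalIntegral.integral_sub (by simp) (by simp), integral_id]
  simp only [intervalIntegral.integral_const, smul_eq_mul]
  nlinarith [mul_nonneg hψ.1 (sub_nonneg.2 hψ.2)]

theorem integral_integral_chord_one_le {g : ℂ → ℂ} (hg : DiffContOnCl ℂ g (ball 0 1)) :
    ∫ θ in (0 : ℝ)..2 * Real.pi, ∫ t in (0 : ℝ)..1,
        ‖g (1 + t * (circleMap 0 1 θ - 1))‖ * ‖circleMap 0 1 θ - 1‖
      ≤ 2 * Real.pi ^ 2 * Real.circleAverage (fun z => ‖g z‖) 0 1 := by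
  have hpi := Real.pi_pos
  have hN := continuous_comp_circleMap hg
  set μ : Measure ℝ := volume.restrict (Ioc 0 (2 * Real.pi)) with hμ
  have hNi : Integrable (fun ψ : ℝ => ‖g (circleMap 0 1 ψ)‖) μ :=
    (hN.norm.integrableOn_Icc).mono_set Ioc_subset_Icc_self
  have hprod : Integrable (Function.uncurry fun θ ψ : ℝ =>
      ‖g (circleMap 0 1 ψ)‖ * oppositeArc θ ψ) (μ.prod μ) := by
    refine Integrable.mul_bdd (c := 2 * Real.pi) (hNi.comp_snd μ)
      measurable_oppositeArc.aestronglyMeasurable ?_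
    have h1 : ∀ᵐ p ∂(μ.prod μ), p.1 ∈ Ioc 0 (2 * Real.pi) :=
      Measure.quasiMeasurePreserving_fst.ae (ae_restrict_mem measurableSet_Ioc)
    filter_upwards [h1] with p hp
    have := oppositeArc_mem_Icc (ψ := p.2) (Ioc_subset_Icc_self hp)
    refine (Real.norm_of_nonneg this.1).trans_le ?_
    exact this.2
  have hle : 0 ≤ 2 * Real.pi := by positivity
  rw [intervalIntegral.integral_of_le hle]
  calc ∫ θ, (∫ t in (0 : ℝ)..1,
        ‖g (1 + t * (circleMap 0 1 θ - 1))‖ * ‖circleMap 0 1 θ - 1‖) ∂μ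
      ≤ ∫ θ, (2 * Real.pi)⁻¹ * ∫ ψ, ‖g (circleMap 0 1 ψ)‖ * oppositeArc θ ψ ∂μ ∂μ := by
        refine integral_mono_of_nonneg (ae_of_all _ fun θ => ?_)
          (hprod.integral_prod_left.const_mul _) ?_
        · exact intervalIntegral.integral_nonneg zero_le_one fun t _ => by positivity
        · filter_upwards [ae_restrict_mem measurableSet_Ioc,
            ae_restrict_of_ae (Measure.ae_ne volume (2 * Real.pi))] with θ h1 h2
          have := integral_chord_le hg ⟨h1.1, lt_of_le_of_ne h1.2 h2⟩
          rwa [intervalIntegral.integral_of_le hle] at this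
    _ = (2 * Real.pi)⁻¹ * ∫ ψ, ∫ θ, ‖g (circleMap 0 1 ψ)‖ * oppositeArc θ ψ ∂μ ∂μ := by
        rw [integral_const_mul, integral_integral_swap hprod]
    _ ≤ (2 * Real.pi)⁻¹ * ∫ ψ, ‖g (circleMap 0 1 ψ)‖ * (2 * Real.pi ^ 2) ∂μ := by
        gcongr ?_ * ?_
        refine integral_mono_ae hprod.integral_prod_right (hNi.mul_const _) ?_
        filter_upwards [ae_restrict_mem measurableSet_Ioc] with ψ hψ
        rw [integral_const_mul, ← intervalIntegral.integral_of_le hle]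
        gcongr
        exact integral_oppositeArc_le (Ioc_subset_Icc_self hψ)
    _ = _ := by
        rw [integral_mul_const, Real.circleAverage_def, intervalIntegral.integral_of_le hle,
          smul_eq_mul]
        ring

theorem circleMap_mul_circleMap (θ α : ℝ) :
    circleMap 0 1 α * circleMap 0 1 θ = circleMap 0 1 (θ + α) := by
  simp only [circleMap, Complex.ofReal_one, one_mul, zero_add, ← Complex.exp_add]
  congr 1
  push_cast
  ring

theorem diffContOnCl_comp_mul {g : ℂ → ℂ} (hg : DiffContOnCl ℂ g (ball 0 1)) {a : ℂ}
    (ha : ‖a‖ = 1) : DiffContOnCl ℂ (fun z => g (a * z)) (ball 0 1) := by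
  refine hg.comp (Differentiable.diffContOnCl (by fun_prop)) fun z hz => ?_
  simpa [ha] using hz

theorem circleAverage_comp_mul (u : ℂ → ℝ) (α : ℝ) :
    Real.circleAverage (fun z => u (circleMap 0 1 α * z)) 0 1 = Real.circleAverage u 0 1 := by
  rw [Real.circleAverage_eq_integral_add (f := u) α, Real.circleAverage_def]
  simp only [circleMap_mul_circleMap]

theorem exists_circleMap_eq {a : ℂ} (ha : ‖a‖ = 1) : ∃ α : ℝ, circleMap 0 1 α = a := by
  have : a ∈ range (circleMap 0 1) := by
    rw [range_circleMap]; simpa using ha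
  exact this

/-- Rotating `a` to `1` reduces this to `integral_integral_chord_one_le`; the induced shift of the
angle is harmless by periodicity. -/
theorem integral_integral_chord_le {g : ℂ → ℂ} (hg : DiffContOnCl ℂ g (ball 0 1)) {a : ℂ}
    (ha : ‖a‖ = 1) :
    ∫ θ in (0 : ℝ)..2 * Real.pi, ∫ t in (0 : ℝ)..1,
        ‖g (a + t * (circleMap 0 1 θ - a))‖ * ‖circleMap 0 1 θ - a‖
      ≤ 2 * Real.pi ^ 2 * Real.circleAverage (fun z => ‖g z‖) 0 1 := by
  obtain ⟨α, rfl⟩ := exists_circleMap_eq ha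
  have h := integral_integral_chord_one_le (diffContOnCl_comp_mul hg ha)
  rw [circleAverage_comp_mul (fun z => ‖g z‖)] at h
  refine le_trans (le_of_eq ?_) h
  set φ : ℝ → ℝ := fun θ => ∫ t in (0 : ℝ)..1, ‖g (circleMap 0 1 α
    + t * (circleMap 0 1 θ - circleMap 0 1 α))‖ * ‖circleMap 0 1 θ - circleMap 0 1 α‖ with hφ
  have hper : Function.Periodic φ (2 * Real.pi) := fun θ => by
    simp only [hφ, periodic_circleMap 0 1 θ]
  have h1 := hper.intervalIntegral_add_eq 0 α
  rw [zero_add, add_comm α] at h1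
  rw [h1]
  have h2 := intervalIntegral.integral_comp_add_right (a := 0) (b := 2 * Real.pi) φ α
  rw [zero_add] at h2
  rw [← h2]
  congr 1
  ext θ
  simp only [hφ, ← circleMap_mul_circleMap]
  congr 1
  ext t
  have e1 : circleMap 0 1 α * circleMap 0 1 θ - circleMap 0 1 α
    = circleMap 0 1 α * (circleMap 0 1 θ - 1) := by ring
  have e2 : circleMap 0 1 α + t * (circleMap 0 1 α * (circleMap 0 1 θ - 1))
    = circleMap 0 1 α * (1 + t * (circleMap 0 1 θ - 1)) := by ring
  rw [e1, e2, norm_mul, ha, one_mul]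

theorem integral_radius_le {g : ℂ → ℂ} (hg : DiffContOnCl ℂ g (ball 0 1)) {a : ℂ}
    (ha : ‖a‖ = 1) :
    ∫ t in (0 : ℝ)..1, ‖g (t * a)‖
      ≤ 2 * Real.pi * Real.circleAverage (fun z => ‖g z‖) 0 1 := by
  obtain ⟨α, rfl⟩ := exists_circleMap_eq ha
  have hpi := Real.pi_pos
  set G : ℂ → ℂ := fun z => g (circleMap 0 1 α * z) with hG
  have hGd : DiffContOnCl ℂ G (ball 0 1) := diffContOnCl_comp_mul hg ha
  have hN := continuous_comp_circleMap hGd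
  have hle : 0 ≤ 2 * Real.pi := by positivity
  have hmem : Real.pi ∈ Icc 0 (2 * Real.pi) := ⟨hpi.le, by linarith⟩
  -- After a rotation the radius is half of the diameter from `1` to `-1`, the chord with `θ = π`.
  -- The crude bound `2π` for the opposite arc is enough, since only boundedness of `f` depends on
  -- it.
  have h1 := integral_chord_le hGd (θ := Real.pi) ⟨hpi, by linarith⟩
  have h2 : (2 * Real.pi)⁻¹ * ∫ ψ in (0 : ℝ)..2 * Real.pi,
      ‖G (circleMap 0 1 ψ)‖ * oppositeArc Real.pi ψ
      ≤ 2 * Real.pi * Real.circleAverage (fun z => ‖G z‖) 0 1 := by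
    rw [Real.circleAverage_def, smul_eq_mul, mul_left_comm]
    gcongr ?_ * ?_
    rw [← intervalIntegral.integral_const_mul]
    rw [intervalIntegral.integral_of_le hle, intervalIntegral.integral_of_le hle]
    refine integral_mono_of_nonneg (ae_of_all _ fun ψ => ?_) ?_ (ae_of_all _ fun ψ => ?_)
    · exact mul_nonneg (norm_nonneg _) (oppositeArc_mem_Icc hmem).1
    · exact ((continuous_const.mul hN.norm).integrableOn_Icc).mono_set Ioc_subset_Icc_self
    · dsimp only
      rw [mul_comm]
      exact mul_le_mul_of_nonneg_right (oppositeArc_mem_Icc hmem).2 (norm_nonneg _)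
  rw [circleAverage_comp_mul (fun z => ‖g z‖)] at h2
  refine le_trans (le_trans ?_ h1) h2
  have hb : circleMap 0 1 Real.pi = -1 := by simp [circleMap]
  have hn : ‖(-1 - 1 : ℂ)‖ = 2 := by norm_num
  have h3 : ∫ t in (0 : ℝ)..1, ‖G (1 + t * (circleMap 0 1 Real.pi - 1))‖
      * ‖circleMap 0 1 Real.pi - 1‖ = ∫ x in (-1 : ℝ)..1, ‖G x‖ := by
    have := intervalIntegral.integral_comp_sub_mul (a := 0) (b := 1) (fun x : ℝ => ‖G x‖)
      two_ne_zero 1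
    rw [hb, hn, intervalIntegral.integral_mul_const]
    norm_num at this
    have e : ∀ t : ℝ, (1 + t * (-1 - 1) : ℂ) = 1 - 2 * t := fun t => by ring
    simp only [e, this]
    ring
  rw [h3]
  have h4 : ∫ t in (0 : ℝ)..1, ‖g (t * circleMap 0 1 α)‖ = ∫ t in (0 : ℝ)..1, ‖G t‖ := by
    simp only [hG, mul_comm]
  rw [h4]
  refine intervalIntegral.integral_mono_interval (by norm_num) zero_le_one le_rfl
    (ae_of_all _ fun x => norm_nonneg _) ?_
  rw [intervalIntegrable_iff_integrableOn_Icc_of_le (by norm_num)]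
  refine ContinuousOn.integrableOn_Icc (hGd.continuousOn_ball.norm.comp (by fun_prop) ?_)
  intro x hx
  simpa [abs_le] using hx

/-! ### The chordal representation of the Toeplitz operator -/

/-- The Cauchy transform of an integrable function on the circle is analytic in the disc. -/
theorem differentiableOn_circleAverage_cauchy {k : ℂ → ℂ} (hk : CircleIntegrable k 0 1) :
    DifferentiableOn ℂ (fun z => Real.circleAverage (fun ζ => k ζ / (1 - conj ζ * z)) 0 1)
      (ball 0 1) := by
  have h := hasFPowerSeriesOn_cauchy_integral (R := 1) (by simpa using hk) one_pos
  have h2 := h.differentiableOn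
  have h3 : Metric.eball (0 : ℂ) ((1 : NNReal) : ENNReal) = ball 0 1 := by
    rw [Metric.eball_coe]; simp
  rw [h3] at h2
  refine h2.congr fun z _ => ?_
  rw [Real.circleAverage_eq_circleIntegral one_ne_zero]
  congr 1
  refine circleIntegral.integral_congr zero_le_one fun ζ hζ => ?_
  have h1 : ‖ζ‖ = 1 := by simpa using hζ
  have h0 : ζ ≠ 0 := by rintro rfl; simp at h1
  have hc : conj ζ = ζ⁻¹ := by rw [Complex.inv_eq_conj h1]
  have e : 1 - conj ζ * z = ζ⁻¹ * (ζ - z) := by rw [hc]; field_simp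
  simp only [smul_eq_mul, sub_zero, e, div_eq_mul_inv, mul_inv, inv_inv]
  field_simp

theorem circleAverage_cauchy_eq {k : ℂ → ℂ} {z : ℂ} :
    Real.circleAverage (fun ζ => k ζ / (1 - conj ζ * z)) 0 1
      = (2 * Real.pi * Complex.I)⁻¹ * ∫ θ in (0 : ℝ)..2 * Real.pi, k (circleMap 0 1 θ)
        * (Complex.I * circleMap 0 1 θ / (circleMap 0 1 θ - z)) := by
  have hc : (((2 * Real.pi)⁻¹ : ℝ) : ℂ) = (2 * Real.pi * Complex.I)⁻¹ * Complex.I := by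
    push_cast
    field_simp
  rw [Real.circleAverage_def, Complex.real_smul, hc, mul_assoc,
    ← intervalIntegral.integral_const_mul Complex.I]
  congr 2
  ext θ
  have h1 : ‖circleMap 0 1 θ‖ = 1 := by simp
  set ζ := circleMap 0 1 θ
  have h0 : ζ ≠ 0 := by rintro h; simp [h] at h1
  have hc : conj ζ = ζ⁻¹ := by rw [Complex.inv_eq_conj h1]
  have e : 1 - conj ζ * z = ζ⁻¹ * (ζ - z) := by rw [hc]; field_simp
  rw [e]
  have := Complex.I_ne_zero
  simp only [div_eq_mul_inv, mul_inv, inv_inv]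
  field_simp

/-- The kernel of the chordal representation of the Toeplitz operator. -/
noncomputable def chordKernel (z b : ℂ) : ℂ :=
  conj (b - z) * (Complex.I * b / (b - z)) + Complex.I * conj b

theorem norm_chordKernel_le {z b : ℂ} (hb : ‖b‖ = 1) : ‖chordKernel z b‖ ≤ 2 := by
  refine (norm_add_le _ _).trans ?_
  rw [norm_mul, norm_mul, norm_div, norm_mul, RCLike.norm_conj, RCLike.norm_conj, hb,
    Complex.norm_I, one_mul, mul_one_div]
  linarith [div_self_le_one ‖b - z‖]

/-- With `conj b = 1/b` and `conj z = 1/z` the first summand collapses to `-i conj z`, so the kernel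
is `i conj (b - z)`. The factor `|b - z|` is what turns `dt` into arc length on the chord. -/
theorem norm_chordKernel_of_norm_eq_one {z b : ℂ} (hb : ‖b‖ = 1) (hz : ‖z‖ = 1) (hbz : b ≠ z) :
    ‖chordKernel z b‖ = ‖b - z‖ := by
  have h0 : b ≠ 0 := by rintro rfl; simp at hb
  have hz0 : z ≠ 0 := by rintro rfl; simp at hz
  have h1 : b - z ≠ 0 := sub_ne_zero.2 hbz
  have e : chordKernel z b = Complex.I * conj (b - z) := by
    rw [chordKernel, map_sub, ← Complex.inv_eq_conj hb, ← Complex.inv_eq_conj hz]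
    field_simp
    ring
  rw [e, norm_mul, Complex.norm_I, one_mul, RCLike.norm_conj]

theorem intervalIntegral_swap_of_continuousOn {F : ℝ → ℝ → ℂ} {A B : ℝ} (hA : 0 ≤ A) (hB : 0 ≤ B)
    (hF : ContinuousOn (Function.uncurry F) (Icc 0 A ×ˢ Icc 0 B)) :
    ∫ x in (0 : ℝ)..A, ∫ y in (0 : ℝ)..B, F x y = ∫ y in (0 : ℝ)..B, ∫ x in (0 : ℝ)..A, F x y := by
  simp only [intervalIntegral.integral_of_le hA, intervalIntegral.integral_of_le hB]
  refine integral_integral_swap ?_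
  rw [Measure.prod_restrict]
  exact (hF.integrableOn_compact (isCompact_Icc.prod isCompact_Icc)).mono_set
    (prod_mono Ioc_subset_Icc_self Ioc_subset_Icc_self)

theorem continuousOn_chord_param {u : ℂ → ℂ} (hu : ContinuousOn u (closedBall 0 1)) {z : ℂ}
    (hz : ‖z‖ ≤ 1) :
    ContinuousOn (fun p : ℝ × ℝ => u (z + p.2 * (circleMap 0 1 p.1 - z)))
      (Icc 0 (2 * Real.pi) ×ˢ Icc 0 1) := by
  refine hu.comp (by fun_prop) fun p hp => ?_
  exact add_smul_sub_mem_closedBall hz (by simp) hp.2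

section Chordal

variable {f h : ℂ → ℂ} {R : ℝ}

theorem continuousOn_closedBall_of_differentiableOn (hR : 1 < R)
    (hf : DifferentiableOn ℂ f (ball 0 R)) : ContinuousOn f (closedBall 0 1) :=
  hf.continuousOn.mono (closedBall_subset_ball hR)

theorem hasDerivAt_of_mem_closedBall (hR : 1 < R) (hf : DifferentiableOn ℂ f (ball 0 R)) {w : ℂ}
    (hw : w ∈ closedBall (0 : ℂ) 1) : HasDerivAt f (deriv f w) w :=
  (hf.differentiableAt (isOpen_ball.mem_nhds (closedBall_subset_ball hR hw))).hasDerivAt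

theorem hasDerivAt_conj_mul (hR : 1 < R) (hf : DifferentiableOn ℂ f (ball 0 R))
    (hh : DifferentiableOn ℂ h (ball 0 R)) {w : ℝ → ℂ} {w' : ℂ} {t : ℝ} (hw : HasDerivAt w w' t)
    (hwt : w t ∈ closedBall (0 : ℂ) 1) :
    HasDerivAt (fun t => conj (f (w t)) * h (w t))
      (conj (deriv f (w t)) * conj w' * h (w t) + conj (f (w t)) * deriv h (w t) * w') t := by
  have h1 := ((hasDerivAt_of_mem_closedBall hR hf hwt).comp t hw).star
  have h2 := (hasDerivAt_of_mem_closedBall hR hh hwt).comp t hw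
  refine (h1.mul h2).congr_deriv ?_
  simp only [Function.comp_apply, ← starRingEnd_apply, map_mul]
  ring

/-- The difference of the two integrands, times `t`, is the angular derivative of `conj f * h` along
a closed curve, so it integrates to zero. This is what removes `h'` from the representation. -/
theorem integral_tangential (hR : 1 < R) (hf : DifferentiableOn ℂ f (ball 0 R))
    (hh : DifferentiableOn ℂ h (ball 0 R)) {z : ℂ} (hz : ‖z‖ ≤ 1) {t : ℝ} (ht : t ∈ Ioc (0 : ℝ) 1) :
    ∫ θ in (0 : ℝ)..2 * Real.pi, conj (f (z + t * (circleMap 0 1 θ - z)))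
        * deriv h (z + t * (circleMap 0 1 θ - z)) * (Complex.I * circleMap 0 1 θ)
      = ∫ θ in (0 : ℝ)..2 * Real.pi, conj (deriv f (z + t * (circleMap 0 1 θ - z)))
        * h (z + t * (circleMap 0 1 θ - z)) * (Complex.I * conj (circleMap 0 1 θ)) := by
  have hcf := continuousOn_closedBall_of_differentiableOn hR hf
  have hch := continuousOn_closedBall_of_differentiableOn hR hh
  have hcf' := continuousOn_closedBall_of_differentiableOn hR (hf.deriv isOpen_ball)
  have hch' := continuousOn_closedBall_of_differentiableOn hR (hh.deriv isOpen_ball)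
  set w : ℝ → ℂ := fun θ => z + t * (circleMap 0 1 θ - z) with hw
  have hwm : ∀ θ, w θ ∈ closedBall (0 : ℂ) 1 := fun θ =>
    add_smul_sub_mem_closedBall hz (by simp) ⟨ht.1.le, ht.2⟩
  have hwc : Continuous w := by fun_prop
  have hcomp : ∀ {u : ℂ → ℂ}, ContinuousOn u (closedBall 0 1) → Continuous fun θ => u (w θ) :=
    fun hu => hu.comp_continuous hwc hwm
  have hb : Continuous fun θ => circleMap 0 1 θ := continuous_circleMap 0 1
  have hconj : Continuous (starRingEnd ℂ) := Complex.continuous_conj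
  have c1 := hcomp hcf
  have c2 := hcomp hch
  have c3 := hcomp hcf'
  have c4 := hcomp hch'
  have hd : ∀ θ, HasDerivAt (fun θ => conj (f (w θ)) * h (w θ))
      (t * (conj (f (w θ)) * deriv h (w θ) * (Complex.I * circleMap 0 1 θ)
        - conj (deriv f (w θ)) * h (w θ) * (Complex.I * conj (circleMap 0 1 θ)))) θ := by
    intro θ
    have h1 : HasDerivAt w (t * (circleMap 0 1 θ * Complex.I)) θ :=
      (((hasDerivAt_circleMap 0 1 θ).sub_const z).const_mul (t : ℂ)).const_add z
    refine (hasDerivAt_conj_mul hR hf hh h1 (hwm θ)).congr_deriv ?_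
    simp only [map_mul, Complex.conj_I, Complex.conj_ofReal]
    ring
  have cont1 : Continuous fun θ => conj (f (w θ)) * deriv h (w θ)
      * (Complex.I * circleMap 0 1 θ) :=
    ((hconj.comp c1).mul c4).mul (continuous_const.mul hb)
  have cont2 : Continuous fun θ => conj (deriv f (w θ)) * h (w θ)
      * (Complex.I * conj (circleMap 0 1 θ)) :=
    ((hconj.comp c3).mul c2).mul (continuous_const.mul (hconj.comp hb))
  have hint := intervalIntegral.integral_eq_sub_of_hasDerivAt (a := 0) (b := 2 * Real.pi)
    (fun θ _ => hd θ) ((continuous_const.mul (cont1.sub cont2)).intervalIntegrable _ _)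
  have hper : w (2 * Real.pi) = w 0 := by
    simp only [hw]
    rw [show (2 * Real.pi) = 0 + 2 * Real.pi by ring, periodic_circleMap 0 1 0]
  rw [hper, sub_self, intervalIntegral.integral_const_mul,
    intervalIntegral.integral_sub (cont1.intervalIntegrable _ _) (cont2.intervalIntegrable _ _)]
    at hint
  -- The curve degenerates to a point at `t = 0`, where the common factor `t` could not be
  -- cancelled.
  have ht0 : (t : ℂ) ≠ 0 := by exact_mod_cast ht.1.ne'
  exact sub_eq_zero.1 ((mul_eq_zero.1 hint).resolve_left ht0)

theorem integral_radial (hR : 1 < R) (hf : DifferentiableOn ℂ f (ball 0 R))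
    (hh : DifferentiableOn ℂ h (ball 0 R)) {z b : ℂ} (hz : ‖z‖ ≤ 1) (hb : ‖b‖ ≤ 1) :
    ∫ t in (0 : ℝ)..1, (conj (deriv f (z + t * (b - z))) * conj (b - z) * h (z + t * (b - z))
        + conj (f (z + t * (b - z))) * deriv h (z + t * (b - z)) * (b - z))
      = conj (f b) * h b - conj (f z) * h z := by
  have hcf := continuousOn_closedBall_of_differentiableOn hR hf
  have hch := continuousOn_closedBall_of_differentiableOn hR hh
  have hcf' := continuousOn_closedBall_of_differentiableOn hR (hf.deriv isOpen_ball)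
  have hch' := continuousOn_closedBall_of_differentiableOn hR (hh.deriv isOpen_ball)
  have hconj : Continuous (starRingEnd ℂ) := Complex.continuous_conj
  rw [intervalIntegral.integral_eq_sub_of_hasDerivAt
    (f := fun t : ℝ => conj (f (z + t * (b - z))) * h (z + t * (b - z)))]
  · simp
  · intro t ht
    rw [uIcc_of_le zero_le_one] at ht
    refine hasDerivAt_conj_mul (w := fun t : ℝ => z + t * (b - z)) hR hf hh ?_
      (add_smul_sub_mem_closedBall hz hb ht)
    simpa using ((hasDerivAt_id t).ofReal_comp.mul_const (b - z)).const_add z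
  · apply ContinuousOn.intervalIntegrable
    rw [uIcc_of_le zero_le_one]
    exact (((hconj.comp_continuousOn (continuousOn_chord hcf' hz hb)).mul continuousOn_const).mul
      (continuousOn_chord hch hz hb)).add
      (((hconj.comp_continuousOn (continuousOn_chord hcf hz hb)).mul
        (continuousOn_chord hch' hz hb)).mul continuousOn_const)

/-- Subtracting `conj f(z) h(z)` from the density cancels the singular denominator: the fundamental
theorem along the chord yields `P`, with `f'`, and `Q`, with `h'`. The tangential identity replaces
`Q` by `Q'` after exchanging the integrals, and `P + Q'` carries exactly `chordKernel`. -/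
theorem integral_chordal_representation (hR : 1 < R) (hf : DifferentiableOn ℂ f (ball 0 R))
    (hh : DifferentiableOn ℂ h (ball 0 R)) {z : ℂ} (hz : z ∈ ball (0 : ℂ) 1) :
    ∫ θ in (0 : ℝ)..2 * Real.pi, conj (f (circleMap 0 1 θ)) * h (circleMap 0 1 θ)
        * (Complex.I * circleMap 0 1 θ / (circleMap 0 1 θ - z))
      = 2 * Real.pi * Complex.I * (conj (f z) * h z)
        + ∫ θ in (0 : ℝ)..2 * Real.pi, ∫ t in (0 : ℝ)..1,
          conj (deriv f (z + t * (circleMap 0 1 θ - z))) * h (z + t * (circleMap 0 1 θ - z))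
            * chordKernel z (circleMap 0 1 θ) := by
  have hz1 : ‖z‖ ≤ 1 := (mem_ball_zero_iff.1 hz).le
  have hcf := continuousOn_closedBall_of_differentiableOn hR hf
  have hch := continuousOn_closedBall_of_differentiableOn hR hh
  have hcf' := continuousOn_closedBall_of_differentiableOn hR (hf.deriv isOpen_ball)
  have hch' := continuousOn_closedBall_of_differentiableOn hR (hh.deriv isOpen_ball)
  have hconj : Continuous (starRingEnd ℂ) := Complex.continuous_conj
  have hle : 0 ≤ 2 * Real.pi := by positivity
  have hne : ∀ θ, circleMap 0 1 θ - z ≠ 0 := fun θ =>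
    sub_ne_zero.2 (circleMap_ne_mem_ball hz θ)
  have p1 := continuousOn_chord_param hcf hz1
  have p2 := continuousOn_chord_param hch hz1
  have p3 := continuousOn_chord_param hcf' hz1
  have p4 := continuousOn_chord_param hch' hz1
  have hbc : Continuous fun p : ℝ × ℝ => circleMap 0 1 p.1 := by fun_prop
  have hqc : Continuous fun p : ℝ × ℝ =>
      Complex.I * circleMap 0 1 p.1 / (circleMap 0 1 p.1 - z) :=
    (continuous_const.mul hbc).div (hbc.sub continuous_const) fun p => hne p.1
  set w : ℝ → ℝ → ℂ := fun θ t => z + t * (circleMap 0 1 θ - z) with hw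
  set P : ℝ → ℝ → ℂ := fun θ t => conj (deriv f (w θ t)) * conj (circleMap 0 1 θ - z) * h (w θ t)
    * (Complex.I * circleMap 0 1 θ / (circleMap 0 1 θ - z)) with hP
  set Q : ℝ → ℝ → ℂ := fun θ t => conj (f (w θ t)) * deriv h (w θ t)
    * (Complex.I * circleMap 0 1 θ) with hQ
  set Q' : ℝ → ℝ → ℂ := fun θ t => conj (deriv f (w θ t)) * h (w θ t)
    * (Complex.I * conj (circleMap 0 1 θ)) with hQ'
  have cP : ContinuousOn (Function.uncurry P) (Icc 0 (2 * Real.pi) ×ˢ Icc 0 1) :=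
    (((hconj.comp_continuousOn p3).mul
      (hconj.comp (hbc.sub continuous_const)).continuousOn).mul p2).mul hqc.continuousOn
  have cQ : ContinuousOn (Function.uncurry Q) (Icc 0 (2 * Real.pi) ×ˢ Icc 0 1) :=
    ((hconj.comp_continuousOn p1).mul p4).mul (continuous_const.mul hbc).continuousOn
  have cQ' : ContinuousOn (Function.uncurry Q') (Icc 0 (2 * Real.pi) ×ˢ Icc 0 1) :=
    ((hconj.comp_continuousOn p3).mul p2).mul (continuous_const.mul (hconj.comp hbc)).continuousOn
  have hinner : ∀ {F : ℝ → ℝ → ℂ},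
      ContinuousOn (Function.uncurry F) (Icc 0 (2 * Real.pi) ×ˢ Icc 0 1) →
      ∀ θ ∈ Icc 0 (2 * Real.pi), IntervalIntegrable (F θ) volume 0 1 := by
    intro F hF θ hθ
    apply ContinuousOn.intervalIntegrable
    rw [uIcc_of_le zero_le_one]
    exact hF.comp (f := fun t => (θ, t)) (by fun_prop) fun t ht => ⟨hθ, ht⟩
  have houter : ∀ {F : ℝ → ℝ → ℂ},
      ContinuousOn (Function.uncurry F) (Icc 0 (2 * Real.pi) ×ˢ Icc 0 1) →
      IntervalIntegrable (fun θ => ∫ t in (0 : ℝ)..1, F θ t) volume 0 (2 * Real.pi) := by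
    intro F hF
    simp only [intervalIntegral.integral_of_le zero_le_one]
    rw [intervalIntegrable_iff_integrableOn_Ioc_of_le hle]
    have hi : Integrable (Function.uncurry F)
        ((volume.restrict (Ioc 0 (2 * Real.pi))).prod (volume.restrict (Ioc (0 : ℝ) 1))) := by
      rw [Measure.prod_restrict]
      exact (hF.integrableOn_compact (isCompact_Icc.prod isCompact_Icc)).mono_set
        (prod_mono Ioc_subset_Icc_self Ioc_subset_Icc_self)
    exact hi.integral_prod_left
  have hswap : ∫ θ in (0 : ℝ)..2 * Real.pi, ∫ t in (0 : ℝ)..1, Q θ t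
      = ∫ θ in (0 : ℝ)..2 * Real.pi, ∫ t in (0 : ℝ)..1, Q' θ t := by
    rw [intervalIntegral_swap_of_continuousOn hle zero_le_one cQ,
      intervalIntegral_swap_of_continuousOn hle zero_le_one cQ']
    refine intervalIntegral.integral_congr_ae (ae_of_all _ fun t ht => ?_)
    rw [uIoc_of_le zero_le_one] at ht
    exact integral_tangential hR hf hh hz1 ht
  have hcauchy : ∫ θ in (0 : ℝ)..2 * Real.pi,
      Complex.I * circleMap 0 1 θ / (circleMap 0 1 θ - z) = 2 * Real.pi * Complex.I := by
    rw [← circleIntegral.integral_sub_inv_of_mem_ball hz, circleIntegral]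
    congr 1
    ext θ
    rw [deriv_circleMap, smul_eq_mul]
    ring
  have hdiff : ∫ θ in (0 : ℝ)..2 * Real.pi, (conj (f (circleMap 0 1 θ)) * h (circleMap 0 1 θ)
        * (Complex.I * circleMap 0 1 θ / (circleMap 0 1 θ - z))
        - conj (f z) * h z * (Complex.I * circleMap 0 1 θ / (circleMap 0 1 θ - z)))
      = ∫ θ in (0 : ℝ)..2 * Real.pi, ((∫ t in (0 : ℝ)..1, P θ t) + ∫ t in (0 : ℝ)..1, Q θ t) := by
    refine intervalIntegral.integral_congr fun θ hθ => ?_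
    rw [uIcc_of_le hle] at hθ
    rw [← sub_mul, ← integral_radial hR hf hh hz1 (b := circleMap 0 1 θ) (by simp),
      ← intervalIntegral.integral_add (hinner cP θ hθ) (hinner cQ θ hθ),
      ← intervalIntegral.integral_mul_const]
    congr 1
    ext t
    have := hne θ
    simp only [hP, hQ, hw]
    field_simp
  have hsphere : ∀ {u : ℂ → ℂ}, ContinuousOn u (closedBall 0 1) →
      Continuous fun θ => u (circleMap 0 1 θ) := fun hu =>
    hu.comp_continuous (continuous_circleMap 0 1)
      fun θ => sphere_subset_closedBall (circleMap_mem_sphere 0 zero_le_one θ)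
  have hq1 : Continuous fun θ => Complex.I * circleMap 0 1 θ / (circleMap 0 1 θ - z) :=
    (continuous_const.mul (continuous_circleMap 0 1)).div
      ((continuous_circleMap 0 1).sub continuous_const) hne
  have hi1 : Continuous fun θ => conj (f (circleMap 0 1 θ)) * h (circleMap 0 1 θ)
      * (Complex.I * circleMap 0 1 θ / (circleMap 0 1 θ - z)) :=
    ((hconj.comp (hsphere hcf)).mul (hsphere hch)).mul hq1
  rw [intervalIntegral.integral_sub (hi1.intervalIntegrable _ _)
    ((continuous_const.fun_mul hq1).intervalIntegrable _ _), intervalIntegral.integral_const_mul,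
    hcauchy, intervalIntegral.integral_add (houter cP) (houter cQ), hswap,
    ← intervalIntegral.integral_add (houter cP) (houter cQ'), sub_eq_iff_eq_add'] at hdiff
  rw [hdiff, mul_comm (conj (f z) * h z)]
  congr 1
  refine intervalIntegral.integral_congr fun θ hθ => ?_
  rw [uIcc_of_le hle] at hθ
  rw [← intervalIntegral.integral_add (hinner cP θ hθ) (hinner cQ' θ hθ)]
  congr 1
  ext t
  simp only [hP, hQ', chordKernel, hw]
  ring

end Chordal

/-! ### The area term and the bound for functions analytic across the circle -/

/-- The integrand of the chordal representation, as a function of angle and chord parameter. -/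
noncomputable def chordIntegrand (f h : ℂ → ℂ) (z : ℂ) (p : ℝ × ℝ) : ℂ :=
  conj (deriv f (z + p.2 * (circleMap 0 1 p.1 - z))) * h (z + p.2 * (circleMap 0 1 p.1 - z))
    * chordKernel z (circleMap 0 1 p.1)

/-- The area term of the chordal representation. -/
noncomputable def chordIntegral (f h : ℂ → ℂ) (z : ℂ) : ℂ :=
  ∫ p in Ioc 0 (2 * Real.pi) ×ˢ Ioc (0 : ℝ) 1, chordIntegrand f h z p

section Chordal

variable {f h : ℂ → ℂ} {R : ℝ}

theorem aestronglyMeasurable_chordIntegrand (hR : 1 < R) (hf : DifferentiableOn ℂ f (ball 0 R))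
    (hh : DifferentiableOn ℂ h (ball 0 R)) {z : ℂ} (hz : ‖z‖ ≤ 1) :
    AEStronglyMeasurable (chordIntegrand f h z)
      (volume.restrict (Ioc 0 (2 * Real.pi) ×ˢ Ioc (0 : ℝ) 1)) := by
  have p2 := continuousOn_chord_param (continuousOn_closedBall_of_differentiableOn hR hh) hz
  have p3 := continuousOn_chord_param
    (continuousOn_closedBall_of_differentiableOn hR (hf.deriv isOpen_ball)) hz
  have hc := ((Complex.continuous_conj.comp_continuousOn p3).mul p2).mono
    (prod_mono Ioc_subset_Icc_self Ioc_subset_Icc_self)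
  refine (hc.aestronglyMeasurable (measurableSet_Ioc.prod measurableSet_Ioc)).mul ?_
  refine Measurable.aestronglyMeasurable ?_
  unfold chordKernel
  fun_prop

theorem exists_norm_chordIntegrand_le (hR : 1 < R) (hf : DifferentiableOn ℂ f (ball 0 R))
    (hh : DifferentiableOn ℂ h (ball 0 R)) :
    ∃ C : ℝ, ∀ z : ℂ, ‖z‖ ≤ 1 → ∀ p ∈ Ioc 0 (2 * Real.pi) ×ˢ Ioc (0 : ℝ) 1,
      ‖chordIntegrand f h z p‖ ≤ C := by
  obtain ⟨C1, h1⟩ := (isCompact_closedBall (0 : ℂ) 1).exists_bound_of_continuousOn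
    (continuousOn_closedBall_of_differentiableOn hR (hf.deriv isOpen_ball))
  obtain ⟨C2, h2⟩ := (isCompact_closedBall (0 : ℂ) 1).exists_bound_of_continuousOn
    (continuousOn_closedBall_of_differentiableOn hR hh)
  refine ⟨C1 * C2 * 2, fun z hz p hp => ?_⟩
  have hw := add_smul_sub_mem_closedBall (b := circleMap 0 1 p.1) hz (by simp)
    (Ioc_subset_Icc_self hp.2)
  have h3 := h1 _ hw
  have h4 := h2 _ hw
  have h5 := norm_chordKernel_le (z := z) (b := circleMap 0 1 p.1) (by simp)
  rw [chordIntegrand, norm_mul, norm_mul, RCLike.norm_conj]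
  have := (norm_nonneg _).trans h3
  have := (norm_nonneg _).trans h4
  gcongr

theorem volume_restrict_prod_lt_top :
    volume (Ioc 0 (2 * Real.pi) ×ˢ Ioc (0 : ℝ) 1) ≠ ⊤ := by
  rw [Measure.volume_eq_prod, Measure.prod_prod]
  exact ENNReal.mul_ne_top measure_Ioc_lt_top.ne measure_Ioc_lt_top.ne

/-- At `b = z` the kernel is discontinuous in `z` and its modulus on the circle is not `|b - z|`;
this exceptional set is null. -/
theorem ae_circleMap_fst_ne (z : ℂ) (S : Set (ℝ × ℝ)) :
    ∀ᵐ p ∂(volume.restrict S), circleMap 0 1 p.1 ≠ z := by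
  refine ae_restrict_of_ae ?_
  have h : ∀ᵐ θ : ℝ, circleMap 0 1 θ ≠ z := by
    rw [ae_iff]
    simp only [ne_eq, not_not]
    exact ((countable_singleton z).preimage_circleMap 0 one_ne_zero).measure_zero _
  exact Measure.quasiMeasurePreserving_fst.ae h

theorem integrableOn_chordIntegrand (hR : 1 < R) (hf : DifferentiableOn ℂ f (ball 0 R))
    (hh : DifferentiableOn ℂ h (ball 0 R)) {z : ℂ} (hz : ‖z‖ ≤ 1) :
    IntegrableOn (chordIntegrand f h z) (Ioc 0 (2 * Real.pi) ×ˢ Ioc (0 : ℝ) 1) := by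
  obtain ⟨C, hC⟩ := exists_norm_chordIntegrand_le hR hf hh
  refine IntegrableOn.of_bound volume_restrict_prod_lt_top.lt_top
    (aestronglyMeasurable_chordIntegrand hR hf hh hz) C ?_
  filter_upwards [ae_restrict_mem (measurableSet_Ioc.prod measurableSet_Ioc)] with p hp
  exact hC z hz p hp

/-- Dominated convergence with a constant bound, available because `chordKernel` is bounded by `2`
uniformly in `z`. Continuity up to the circle is what the maximum principle needs. -/
theorem continuousOn_chordIntegral (hR : 1 < R) (hf : DifferentiableOn ℂ f (ball 0 R))
    (hh : DifferentiableOn ℂ h (ball 0 R)) :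
    ContinuousOn (chordIntegral f h) (closedBall 0 1) := by
  obtain ⟨C, hC⟩ := exists_norm_chordIntegrand_le hR hf hh
  have hmem : ∀ᵐ p ∂(volume.restrict (Ioc 0 (2 * Real.pi) ×ˢ Ioc (0 : ℝ) 1)),
      p ∈ Ioc 0 (2 * Real.pi) ×ˢ Ioc (0 : ℝ) 1 :=
    ae_restrict_mem (measurableSet_Ioc.prod measurableSet_Ioc)
  intro z₀ hz₀
  refine continuousWithinAt_of_dominated (bound := fun _ => C) ?_ ?_ ?_ ?_
  · filter_upwards [self_mem_nhdsWithin] with z hz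
    exact aestronglyMeasurable_chordIntegrand hR hf hh (by simpa using hz)
  · filter_upwards [self_mem_nhdsWithin] with z hz
    filter_upwards [hmem] with p hp
    exact hC z (by simpa using hz) p hp
  · exact integrableOn_const volume_restrict_prod_lt_top
  · have hne : ∀ᵐ p ∂(volume.restrict (Ioc 0 (2 * Real.pi) ×ˢ Ioc (0 : ℝ) 1)),
        circleMap 0 1 p.1 ≠ z₀ := ae_circleMap_fst_ne _ _
    filter_upwards [hmem, hne] with p hp hp0
    have hcw : ContinuousWithinAt (fun z : ℂ => z + p.2 * (circleMap 0 1 p.1 - z))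
        (closedBall 0 1) z₀ := by fun_prop
    have hmaps : MapsTo (fun z : ℂ => z + p.2 * (circleMap 0 1 p.1 - z)) (closedBall 0 1)
        (closedBall 0 1) := fun z hz =>
      add_smul_sub_mem_closedBall (by simpa using hz) (by simp) (Ioc_subset_Icc_self hp.2)
    have hu : ∀ {u : ℂ → ℂ}, ContinuousOn u (closedBall 0 1) →
        ContinuousWithinAt (fun z : ℂ => u (z + p.2 * (circleMap 0 1 p.1 - z)))
          (closedBall 0 1) z₀ := fun hu =>
      ContinuousWithinAt.comp (t := closedBall 0 1) (hu _ (hmaps hz₀)) hcw hmaps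
    have hk : ContinuousAt (fun z : ℂ => chordKernel z (circleMap 0 1 p.1)) z₀ := by
      unfold chordKernel
      have hd : circleMap 0 1 p.1 - z₀ ≠ 0 := sub_ne_zero.2 hp0
      refine ContinuousAt.add (ContinuousAt.mul ?_ (ContinuousAt.div ?_ ?_ hd)) ?_
      · exact Complex.continuous_conj.continuousAt.comp (by fun_prop)
      all_goals fun_prop
    exact ((Complex.continuous_conj.continuousAt.comp_continuousWithinAt
      (hu (continuousOn_closedBall_of_differentiableOn hR (hf.deriv isOpen_ball)))).mul
      (hu (continuousOn_closedBall_of_differentiableOn hR hh))).mul hk.continuousWithinAt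

theorem chordIntegral_eq_integral_integral (hR : 1 < R) (hf : DifferentiableOn ℂ f (ball 0 R))
    (hh : DifferentiableOn ℂ h (ball 0 R)) {z : ℂ} (hz : ‖z‖ ≤ 1) :
    chordIntegral f h z = ∫ θ in (0 : ℝ)..2 * Real.pi, ∫ t in (0 : ℝ)..1,
          conj (deriv f (z + t * (circleMap 0 1 θ - z))) * h (z + t * (circleMap 0 1 θ - z))
            * chordKernel z (circleMap 0 1 θ) := by
  rw [chordIntegral, Measure.volume_eq_prod, setIntegral_prod _
    (integrableOn_chordIntegrand hR hf hh hz), intervalIntegral.integral_of_le (by positivity)]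
  simp only [intervalIntegral.integral_of_le zero_le_one]
  rfl

theorem norm_chordIntegral_le (hR : 1 < R) (hf : DifferentiableOn ℂ f (ball 0 R))
    {H : ℝ} (hH : ∀ w ∈ closedBall (0 : ℂ) 1, ‖h w‖ ≤ H)
    {z : ℂ} (hz : ‖z‖ = 1) :
    ‖chordIntegral f h z‖
      ≤ 2 * Real.pi ^ 2 * Real.circleAverage (fun w => ‖deriv f w‖) 0 1 * H := by
  have hf' : DiffContOnCl ℂ (deriv f) (ball 0 1) := by
    refine (DifferentiableOn.mono (hf.deriv isOpen_ball) ?_).diffContOnCl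
    rw [closure_ball 0 one_ne_zero]
    exact closedBall_subset_ball hR
  have hH0 : 0 ≤ H := (norm_nonneg _).trans (hH 0 (by simp))
  have hmem : ∀ᵐ p ∂(volume.restrict (Ioc 0 (2 * Real.pi) ×ˢ Ioc (0 : ℝ) 1)),
      p ∈ Ioc 0 (2 * Real.pi) ×ˢ Ioc (0 : ℝ) 1 :=
    ae_restrict_mem (measurableSet_Ioc.prod measurableSet_Ioc)
  have hne : ∀ᵐ p ∂(volume.restrict (Ioc 0 (2 * Real.pi) ×ˢ Ioc (0 : ℝ) 1)),
      circleMap 0 1 p.1 ≠ z := ae_circleMap_fst_ne _ _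
  have hint : IntegrableOn (fun p : ℝ × ℝ => ‖deriv f (z + p.2 * (circleMap 0 1 p.1 - z))‖
      * ‖circleMap 0 1 p.1 - z‖) (Ioc 0 (2 * Real.pi) ×ˢ Ioc (0 : ℝ) 1) := by
    have hc := (continuousOn_chord_param hf'.continuousOn_ball hz.le).norm.mul
      (show Continuous fun p : ℝ × ℝ => ‖circleMap 0 1 p.1 - z‖ by fun_prop).continuousOn
    exact (hc.integrableOn_compact (isCompact_Icc.prod isCompact_Icc)).mono_set
      (prod_mono Ioc_subset_Icc_self Ioc_subset_Icc_self)
  calc ‖chordIntegral f h z‖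
      ≤ ∫ p in Ioc 0 (2 * Real.pi) ×ˢ Ioc (0 : ℝ) 1,
        ‖deriv f (z + p.2 * (circleMap 0 1 p.1 - z))‖ * ‖circleMap 0 1 p.1 - z‖ * H := by
        refine norm_integral_le_of_norm_le (hint.mul_const H) ?_
        filter_upwards [hmem, hne] with p hp hp0
        have hw := add_smul_sub_mem_closedBall (b := circleMap 0 1 p.1) hz.le (by simp)
          (Ioc_subset_Icc_self hp.2)
        rw [chordIntegrand, norm_mul, norm_mul, RCLike.norm_conj,
          norm_chordKernel_of_norm_eq_one (by simp) hz hp0, mul_right_comm]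
        gcongr
        exact hH _ hw
    _ = (∫ θ in (0 : ℝ)..2 * Real.pi, ∫ t in (0 : ℝ)..1,
        ‖deriv f (z + t * (circleMap 0 1 θ - z))‖ * ‖circleMap 0 1 θ - z‖) * H := by
        rw [integral_mul_const, Measure.volume_eq_prod, setIntegral_prod _ hint,
          intervalIntegral.integral_of_le (by positivity)]
        simp only [intervalIntegral.integral_of_le zero_le_one]
    _ ≤ _ := by
        gcongr
        exact integral_integral_chord_le hf' hz

/-- The Toeplitz bound for symbols and arguments analytic across the circle. -/
theorem norm_circleAverage_toeplitz_le (hR : 1 < R) (hf : DifferentiableOn ℂ f (ball 0 R))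
    (hh : DifferentiableOn ℂ h (ball 0 R)) {A H : ℝ} (hA : ∀ w ∈ sphere (0 : ℂ) 1, ‖f w‖ ≤ A)
    (hH : ∀ w ∈ closedBall (0 : ℂ) 1, ‖h w‖ ≤ H) {z : ℂ} (hz : z ∈ ball (0 : ℂ) 1) :
    ‖Real.circleAverage (fun ζ => conj (f ζ) * h ζ / (1 - conj ζ * z)) 0 1‖
      ≤ (A + Real.pi * Real.circleAverage (fun w => ‖deriv f w‖) 0 1) * H := by
  have hcf := continuousOn_closedBall_of_differentiableOn hR hf
  have hch := continuousOn_closedBall_of_differentiableOn hR hh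
  set U : ℂ → ℂ := fun z => conj (f z) * h z
    + (2 * Real.pi * Complex.I)⁻¹ * chordIntegral f h z with hU
  have hUeq : EqOn (fun z => Real.circleAverage
      (fun ζ => conj (f ζ) * h ζ / (1 - conj ζ * z)) 0 1) U (ball 0 1) := by
    intro z hz
    simp only [hU]
    rw [circleAverage_cauchy_eq, integral_chordal_representation hR hf hh hz,
      chordIntegral_eq_integral_integral hR hf hh (mem_ball_zero_iff.1 hz).le, mul_add,
      inv_mul_cancel_left₀ Complex.two_pi_I_ne_zero]
  have hk : CircleIntegrable (fun ζ => conj (f ζ) * h ζ) 0 1 :=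
    (((Complex.continuous_conj.comp_continuousOn hcf).mul hch).mono
      sphere_subset_closedBall).circleIntegrable zero_le_one
  -- Analyticity is read off from the Cauchy transform and continuity up to the boundary from the
  -- chordal formula; neither expression shows both.
  have hUd : DiffContOnCl ℂ U (ball 0 1) := by
    refine ⟨(differentiableOn_circleAverage_cauchy hk).congr fun z hz => (hUeq hz).symm, ?_⟩
    rw [closure_ball 0 one_ne_zero]
    exact ((Complex.continuous_conj.comp_continuousOn hcf).mul hch).add
      (continuousOn_const.mul (continuousOn_chordIntegral hR hf hh))
  have hmax := Complex.norm_le_of_forall_mem_frontier_norm_le isBounded_ball hUd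
    (C := (A + Real.pi * Real.circleAverage (fun w => ‖deriv f w‖) 0 1) * H) ?_
    (subset_closure hz)
  · rwa [← hUeq hz] at hmax
  · intro z hz
    rw [frontier_ball 0 one_ne_zero] at hz
    have hz1 : ‖z‖ = 1 := by simpa using hz
    have h1 := norm_chordIntegral_le hR hf hH hz1
    have hA0 : 0 ≤ A := (norm_nonneg _).trans (hA z hz)
    refine (norm_add_le _ _).trans ?_
    rw [add_mul, norm_mul, norm_mul, RCLike.norm_conj]
    have h2 : ‖(2 * Real.pi * Complex.I : ℂ)⁻¹‖ = (2 * Real.pi)⁻¹ := by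
      rw [norm_inv, norm_mul, norm_mul, Complex.norm_I, Complex.norm_real,
        Real.norm_of_nonneg Real.pi_pos.le, mul_one]
      norm_num
    rw [h2]
    gcongr ?_ + ?_
    · exact mul_le_mul (hA z hz) (hH z (sphere_subset_closedBall hz)) (norm_nonneg _) hA0
    · calc _ ≤ (2 * Real.pi)⁻¹ * (2 * Real.pi ^ 2
            * Real.circleAverage (fun w => ‖deriv f w‖) 0 1 * H) := by gcongr
        _ = _ := by
          have := Real.pi_pos
          field_simp

end Chordal

/-! ### Dilations, and boundedness of a function with derivative in the Hardy space -/

theorem differentiableOn_dilation {f : ℂ → ℂ} (hf : DifferentiableOn ℂ f (ball 0 1)) {s : ℝ}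
    (hs : s ∈ Ioo (0 : ℝ) 1) : DifferentiableOn ℂ (fun z => f (s * z)) (ball 0 s⁻¹) := by
  refine hf.comp (by fun_prop) fun z hz => ?_
  rw [mem_ball_zero_iff] at hz ⊢
  rw [norm_mul, Complex.norm_real, Real.norm_of_nonneg hs.1.le]
  calc s * ‖z‖ < s * s⁻¹ := by gcongr; exact hs.1
    _ = 1 := mul_inv_cancel₀ hs.1.ne'

theorem h1Norm_nonneg (g : ℂ → ℂ) : 0 ≤ h1Norm g := by
  refine Real.sSup_nonneg ?_
  rintro _ ⟨r, _, rfl⟩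
  exact Real.circleAverage_nonneg_of_nonneg fun z _ => norm_nonneg _

/-- The chain rule contributes a factor `s < 1`, so the mean for the dilated function is `s` times
the mean of `|f'|` on the circle of radius `s`. -/
theorem circleAverage_deriv_dilation_le {f : ℂ → ℂ} (hf' : MemH1 (deriv f)) {s : ℝ}
    (hs : s ∈ Ioo (0 : ℝ) 1) :
    Real.circleAverage (fun w => ‖deriv (fun z => f (s * z)) w‖) 0 1 ≤ h1Norm (deriv f) := by
  have h1 : Real.circleAverage (fun w => ‖deriv f w‖) 0 s ≤ h1Norm (deriv f) :=
    le_csSup hf'.2 ⟨s, ⟨hs.1.le, hs.2⟩, rfl⟩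
  have h2 : Real.circleAverage (fun w => ‖deriv (fun z => f (s * z)) w‖) 0 1
      = s * Real.circleAverage (fun w => ‖deriv f w‖) 0 s := by
    rw [Real.circleAverage_eq_circleAverage_zero_one (f := fun w => ‖deriv f w‖), ← smul_eq_mul,
      ← Real.circleAverage_fun_smul]
    congr 1
    ext w
    rw [deriv_comp_mul_left, norm_smul, Complex.norm_real, Real.norm_of_nonneg hs.1.le, add_zero,
      smul_eq_mul]
  rw [h2]
  nlinarith [hs.1, hs.2, h1Norm_nonneg (deriv f)]

/-- A function with derivative in `H¹` is bounded. -/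
theorem norm_sub_le_of_memH1_deriv {f : ℂ → ℂ} (hf : DifferentiableOn ℂ f (ball 0 1))
    (hf' : MemH1 (deriv f)) {z : ℂ} (hz : z ∈ ball (0 : ℂ) 1) :
    ‖f z - f 0‖ ≤ 2 * Real.pi * h1Norm (deriv f) := by
  have hB := h1Norm_nonneg (deriv f)
  have hpi := Real.pi_pos
  rcases eq_or_ne z 0 with rfl | hz0
  · simpa using by positivity
  -- Dilating by `|z|` moves `z` to the unit circle and makes `f` analytic beyond it, so that
  -- `integral_radius_le` applies.
  have hs : ‖z‖ ∈ Ioo (0 : ℝ) 1 := ⟨norm_pos_iff.2 hz0, mem_ball_zero_iff.1 hz⟩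
  set s := ‖z‖ with hsdef
  have hsc : (s : ℂ) ≠ 0 := by exact_mod_cast hs.1.ne'
  set a : ℂ := z / s with ha
  have ha1 : ‖a‖ = 1 := by
    rw [ha, norm_div, Complex.norm_real, Real.norm_of_nonneg hs.1.le, ← hsdef, div_self hs.1.ne']
  have hR : 1 < s⁻¹ := (one_lt_inv₀ hs.1).2 hs.2
  have hfs := differentiableOn_dilation hf hs
  set fs : ℂ → ℂ := fun z => f (s * z) with hfsdef
  have hd : DiffContOnCl ℂ (deriv fs) (ball 0 1) := by
    refine (DifferentiableOn.mono (hfs.deriv isOpen_ball) ?_).diffContOnCl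
    rw [closure_ball 0 one_ne_zero]
    exact closedBall_subset_ball hR
  have hmem : ∀ t ∈ Icc (0 : ℝ) 1, (t * a : ℂ) ∈ closedBall (0 : ℂ) 1 := by
    intro t ht
    rw [mem_closedBall_zero_iff, norm_mul, ha1, Complex.norm_real, Real.norm_of_nonneg ht.1]
    linarith [ht.2]
  have hftc : ∫ t in (0 : ℝ)..1, deriv fs (t * a) * a = fs a - fs 0 := by
    rw [intervalIntegral.integral_eq_sub_of_hasDerivAt (f := fun t : ℝ => fs (t * a))]
    · simp
    · intro t ht
      rw [uIcc_of_le zero_le_one] at ht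
      have h1 : HasDerivAt (fun t : ℝ => (t * a : ℂ)) a t := by
        simpa using (hasDerivAt_id t).ofReal_comp.mul_const a
      exact HasDerivAt.comp (h₂ := fs) t (hasDerivAt_of_mem_closedBall hR hfs (hmem t ht)) h1
    · apply ContinuousOn.intervalIntegrable
      rw [uIcc_of_le zero_le_one]
      exact (hd.continuousOn_ball.comp (by fun_prop) hmem).mul continuousOn_const
  have hz' : fs a = f z := by simp only [hfsdef, ha]; congr 1; field_simp
  have h0' : fs 0 = f 0 := by simp [hfsdef]
  rw [← hz', ← h0', ← hftc]
  calc _ ≤ ∫ t in (0 : ℝ)..1, ‖deriv fs (t * a) * a‖ :=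
        intervalIntegral.norm_integral_le_integral_norm zero_le_one
    _ = ∫ t in (0 : ℝ)..1, ‖deriv fs (t * a)‖ := by simp only [norm_mul, ha1, mul_one]
    _ ≤ 2 * Real.pi * Real.circleAverage (fun z => ‖deriv fs z‖) 0 1 := integral_radius_le hd ha1
    _ ≤ _ := by
      gcongr
      exact circleAverage_deriv_dilation_le hf' hs

/-! ### Boundary values and the passage to the limit -/

/-- A sequence of radii increasing to `1`. -/
noncomputable def radius (n : ℕ) : ℝ := 1 - 1 / ((n : ℝ) + 2)

theorem radius_mem (n : ℕ) : radius n ∈ Ioo (0 : ℝ) 1 := by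
  have h : (0 : ℝ) < (n : ℝ) + 2 := by positivity
  refine ⟨sub_pos.2 ((div_lt_one h).2 (by linarith [(Nat.cast_nonneg n : (0 : ℝ) ≤ n)])), ?_⟩
  exact sub_lt_self _ (by positivity)

theorem tendsto_radius : Tendsto radius atTop (𝓝[<] 1) := by
  refine tendsto_nhdsWithin_iff.2 ⟨?_, Eventually.of_forall fun n => (radius_mem n).2⟩
  have h : Tendsto (fun n : ℕ => 1 / ((n : ℝ) + 2)) atTop (𝓝 0) := by
    refine tendsto_const_nhds.div_atTop ?_
    exact tendsto_atTop_add_const_right _ _ tendsto_natCast_atTop_atTop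
  have h1 := h.const_sub 1
  rwa [sub_zero] at h1

section Boundary

variable {f h : ℂ → ℂ} {A H : ℝ}

theorem ae_tendsto_boundaryValue (hf : DifferentiableOn ℂ f (ball 0 1))
    (hA : ∀ z ∈ ball (0 : ℂ) 1, ‖f z‖ ≤ A) :
    ∀ᵐ θ : ℝ, Tendsto (fun n => f (radius n * circleMap 0 1 θ)) atTop
      (𝓝 (boundaryValue f (circleMap 0 1 θ))) := by
  filter_upwards [ae_exists_radial_limit hf hA] with θ hθ
  exact (tendsto_nhds_limUnder hθ).comp tendsto_radius

theorem ae_tendsto_conj_mul (hf : DifferentiableOn ℂ f (ball 0 1))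
    (hA : ∀ z ∈ ball (0 : ℂ) 1, ‖f z‖ ≤ A) (hh : DifferentiableOn ℂ h (ball 0 1))
    (hH : ∀ z ∈ ball (0 : ℂ) 1, ‖h z‖ ≤ H) :
    ∀ᵐ θ : ℝ, Tendsto (fun n => conj (f (radius n * circleMap 0 1 θ))
      * h (radius n * circleMap 0 1 θ)) atTop
      (𝓝 (conj (boundaryValue f (circleMap 0 1 θ)) * boundaryValue h (circleMap 0 1 θ))) := by
  filter_upwards [ae_tendsto_boundaryValue hf hA, ae_tendsto_boundaryValue hh hH] with θ h1 h2
  exact ((Complex.continuous_conj.tendsto _).comp h1).mul h2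

theorem radius_mul_mem_ball (n : ℕ) {ζ : ℂ} (hζ : ‖ζ‖ ≤ 1) :
    (radius n * ζ : ℂ) ∈ ball (0 : ℂ) 1 := by
  have := radius_mem n
  rw [mem_ball_zero_iff, norm_mul, Complex.norm_real, Real.norm_of_nonneg this.1.le]
  nlinarith [this.1, this.2, norm_nonneg ζ]

theorem norm_conj_mul_radius_le (hA : ∀ z ∈ ball (0 : ℂ) 1, ‖f z‖ ≤ A)
    (hH : ∀ z ∈ ball (0 : ℂ) 1, ‖h z‖ ≤ H) (n : ℕ) (θ : ℝ) :
    ‖conj (f (radius n * circleMap 0 1 θ)) * h (radius n * circleMap 0 1 θ)‖ ≤ A * H := by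
  have hm := radius_mul_mem_ball n (ζ := circleMap 0 1 θ) (by simp)
  rw [norm_mul, RCLike.norm_conj]
  have h1 := hA _ hm
  exact mul_le_mul h1 (hH _ hm) (norm_nonneg _) ((norm_nonneg _).trans h1)

theorem continuous_comp_radius (hf : DifferentiableOn ℂ f (ball 0 1)) (n : ℕ) :
    Continuous fun θ : ℝ => f (radius n * circleMap 0 1 θ) :=
  hf.continuousOn.comp_continuous (by fun_prop) fun θ => radius_mul_mem_ball n (by simp)

/-- Measurability and the bound are both inherited from the continuous dilations, which converge
almost everywhere; where the radial limit fails to exist, `boundaryValue` is an arbitrary value. -/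
theorem circleIntegrable_boundaryValue (hf : DifferentiableOn ℂ f (ball 0 1))
    (hA : ∀ z ∈ ball (0 : ℂ) 1, ‖f z‖ ≤ A) (hh : DifferentiableOn ℂ h (ball 0 1))
    (hH : ∀ z ∈ ball (0 : ℂ) 1, ‖h z‖ ≤ H) :
    CircleIntegrable (fun ζ => conj (boundaryValue f ζ) * boundaryValue h ζ) 0 1 := by
  have hlim := ae_tendsto_conj_mul hf hA hh hH
  rw [CircleIntegrable, intervalIntegrable_iff]
  refine IntegrableOn.of_bound (by rw [uIoc_of_le (by positivity)]; exact measure_Ioc_lt_top)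
    (aestronglyMeasurable_of_tendsto_ae atTop (fun n => ?_) (ae_restrict_of_ae hlim)) (A * H) ?_
  · exact ((Complex.continuous_conj.comp (continuous_comp_radius hf n)).mul
      (continuous_comp_radius hh n)).aestronglyMeasurable
  · filter_upwards [ae_restrict_of_ae hlim] with θ hθ
    exact le_of_tendsto hθ.norm (Eventually.of_forall fun n => norm_conj_mul_radius_le hA hH n θ)

theorem one_sub_conj_mul_ne_zero {ζ z : ℂ} (hζ : ‖ζ‖ = 1) (hz : z ∈ ball (0 : ℂ) 1) :
    1 - conj ζ * z ≠ 0 := by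
  intro h0
  have := congrArg norm (sub_eq_zero.1 h0)
  rw [norm_one, norm_mul, RCLike.norm_conj, hζ, one_mul] at this
  rw [mem_ball_zero_iff] at hz
  linarith

theorem circleIntegrable_toeplitzIntegrand (hf : DifferentiableOn ℂ f (ball 0 1))
    (hA : ∀ z ∈ ball (0 : ℂ) 1, ‖f z‖ ≤ A) (hh : DifferentiableOn ℂ h (ball 0 1))
    (hH : ∀ z ∈ ball (0 : ℂ) 1, ‖h z‖ ≤ H) {z : ℂ} (hz : z ∈ ball (0 : ℂ) 1) :
    CircleIntegrable (toeplitzIntegrand f h z) 0 1 := by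
  have hc : ContinuousOn (fun ζ : ℂ => (1 - conj ζ * z)⁻¹) (sphere 0 |1|) := by
    refine ContinuousOn.inv₀ ?_ fun ζ hζ => one_sub_conj_mul_ne_zero (by simpa using hζ) hz
    exact (continuous_const.sub (Complex.continuous_conj.mul continuous_const)).continuousOn
  exact ((circleIntegrable_boundaryValue hf hA hh hH).mul_continuousOn hc)

theorem tendsto_toeplitz (hf : DifferentiableOn ℂ f (ball 0 1))
    (hA : ∀ z ∈ ball (0 : ℂ) 1, ‖f z‖ ≤ A) (hh : DifferentiableOn ℂ h (ball 0 1))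
    (hH : ∀ z ∈ ball (0 : ℂ) 1, ‖h z‖ ≤ H) {z : ℂ} (hz : z ∈ ball (0 : ℂ) 1) :
    Tendsto (fun n => Real.circleAverage (fun ζ => conj (f (radius n * ζ)) * h (radius n * ζ)
      / (1 - conj ζ * z)) 0 1) atTop (𝓝 (toeplitz f h z)) := by
  simp only [toeplitz, Real.circleAverage_def]
  refine Tendsto.const_smul ?_ _
  have hne : ∀ θ, 1 - conj (circleMap 0 1 θ) * z ≠ 0 := fun θ =>
    one_sub_conj_mul_ne_zero (by simp) hz
  have hc : Continuous fun θ => 1 - conj (circleMap 0 1 θ) * z :=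
    continuous_const.sub ((Complex.continuous_conj.comp (continuous_circleMap 0 1)).mul
      continuous_const)
  refine intervalIntegral.tendsto_integral_filter_of_dominated_convergence
    (fun θ => A * H / ‖1 - conj (circleMap 0 1 θ) * z‖) (Eventually.of_forall fun n => ?_)
    (Eventually.of_forall fun n => ae_of_all _ fun θ _ => ?_) ?_ ?_
  · exact (((Complex.continuous_conj.comp (continuous_comp_radius hf n)).mul
      (continuous_comp_radius hh n)).div hc hne).aestronglyMeasurable
  · rw [norm_div]
    gcongr
    exact norm_conj_mul_radius_le hA hH n θ
  · exact (continuous_const.div hc.norm fun θ =>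
      norm_ne_zero_iff.2 (hne θ)).intervalIntegrable _ _
  · filter_upwards [ae_tendsto_conj_mul hf hA hh hH] with θ hθ _
    exact hθ.div_const _

theorem norm_toeplitz_le (hf : DifferentiableOn ℂ f (ball 0 1)) (hf' : MemH1 (deriv f))
    (hA : ∀ z ∈ ball (0 : ℂ) 1, ‖f z‖ ≤ A) (hh : DifferentiableOn ℂ h (ball 0 1))
    (hH : ∀ z ∈ ball (0 : ℂ) 1, ‖h z‖ ≤ H) {z : ℂ} (hz : z ∈ ball (0 : ℂ) 1) :
    ‖toeplitz f h z‖ ≤ (A + Real.pi * h1Norm (deriv f)) * H := by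
  have hH0 : 0 ≤ H := (norm_nonneg _).trans (hH z hz)
  refine le_of_tendsto (tendsto_toeplitz hf hA hh hH hz).norm (Eventually.of_forall fun n => ?_)
  have hs := radius_mem n
  refine (norm_circleAverage_toeplitz_le ((one_lt_inv₀ hs.1).2 hs.2)
    (differentiableOn_dilation hf hs) (differentiableOn_dilation hh hs)
    (fun w hw => hA _ (radius_mul_mem_ball n (by simpa using hw.le)))
    (fun w hw => hH _ (radius_mul_mem_ball n (by simpa using hw))) hz).trans ?_
  have := Real.pi_pos
  gcongr
  exact circleAverage_deriv_dilation_le hf' hs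

theorem circleIntegrable_dilated_toeplitzIntegrand (hf : DifferentiableOn ℂ f (ball 0 1))
    (hh : DifferentiableOn ℂ h (ball 0 1)) {z : ℂ} (hz : z ∈ ball (0 : ℂ) 1) (n : ℕ) :
    CircleIntegrable (fun ζ => conj (f (radius n * ζ)) * h (radius n * ζ) / (1 - conj ζ * z))
      0 1 := by
  refine Continuous.intervalIntegrable ?_ _ _
  exact ((Complex.continuous_conj.comp (continuous_comp_radius hf n)).mul
      (continuous_comp_radius hh n)).div
    (continuous_const.sub ((Complex.continuous_conj.comp (continuous_circleMap 0 1)).mul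
      continuous_const)) fun θ => one_sub_conj_mul_ne_zero (by simp) hz

/-- Boundary values need not be additive where radial limits fail to exist, so additivity is proved
for the dilated integrals and passed to the limit. -/
theorem toeplitz_add {h₁ h₂ : ℂ → ℂ} {H₁ H₂ : ℝ} (hf : DifferentiableOn ℂ f (ball 0 1))
    (hA : ∀ z ∈ ball (0 : ℂ) 1, ‖f z‖ ≤ A) (hh₁ : DifferentiableOn ℂ h₁ (ball 0 1))
    (hH₁ : ∀ z ∈ ball (0 : ℂ) 1, ‖h₁ z‖ ≤ H₁) (hh₂ : DifferentiableOn ℂ h₂ (ball 0 1))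
    (hH₂ : ∀ z ∈ ball (0 : ℂ) 1, ‖h₂ z‖ ≤ H₂) {z : ℂ} (hz : z ∈ ball (0 : ℂ) 1) :
    toeplitz f (h₁ + h₂) z = toeplitz f h₁ z + toeplitz f h₂ z := by
  have h3 := tendsto_toeplitz hf hA (hh₁.add hh₂) (H := H₁ + H₂)
    (fun z hz => (norm_add_le _ _).trans (add_le_add (hH₁ z hz) (hH₂ z hz))) hz
  refine tendsto_nhds_unique h3 (((tendsto_toeplitz hf hA hh₁ hH₁ hz).add
    (tendsto_toeplitz hf hA hh₂ hH₂ hz)).congr fun n => ?_)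
  rw [← Real.circleAverage_fun_add (circleIntegrable_dilated_toeplitzIntegrand hf hh₁ hz n)
    (circleIntegrable_dilated_toeplitzIntegrand hf hh₂ hz n)]
  congr 1
  ext ζ
  simp only [Pi.add_apply]
  ring

theorem toeplitz_smul (hf : DifferentiableOn ℂ f (ball 0 1))
    (hA : ∀ z ∈ ball (0 : ℂ) 1, ‖f z‖ ≤ A) (hh : DifferentiableOn ℂ h (ball 0 1))
    (hH : ∀ z ∈ ball (0 : ℂ) 1, ‖h z‖ ≤ H) (c : ℂ) {z : ℂ} (hz : z ∈ ball (0 : ℂ) 1) :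
    toeplitz f (c • h) z = c * toeplitz f h z := by
  have h3 := tendsto_toeplitz hf hA (hh.const_smul c) (H := ‖c‖ * H)
    (fun z hz => (norm_smul_le c (h z)).trans
      (mul_le_mul_of_nonneg_left (hH z hz) (norm_nonneg _))) hz
  refine tendsto_nhds_unique h3 (((tendsto_toeplitz hf hA hh hH hz).const_mul c).congr fun n => ?_)
  rw [← smul_eq_mul, ← Real.circleAverage_fun_smul]
  congr 1
  ext ζ
  simp only [Pi.smul_apply, smul_eq_mul]
  ring

theorem differentiableOn_toeplitz (hf : DifferentiableOn ℂ f (ball 0 1))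
    (hA : ∀ z ∈ ball (0 : ℂ) 1, ‖f z‖ ≤ A) (hh : DifferentiableOn ℂ h (ball 0 1))
    (hH : ∀ z ∈ ball (0 : ℂ) 1, ‖h z‖ ≤ H) :
    DifferentiableOn ℂ (toeplitz f h) (ball 0 1) :=
  differentiableOn_circleAverage_cauchy (circleIntegrable_boundaryValue hf hA hh hH)

end Boundary

/-! ### The operator on bounded analytic functions -/

theorem norm_extendZero_le (h : HInfty) : ∀ z ∈ ball (0 : ℂ) 1, ‖extendZero h.1 z‖ ≤ ‖h‖ := by
  intro z hz
  rw [show z = ((⟨z, hz⟩ : Disc) : ℂ) from rfl, extendZero_coe]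
  exact h.1.norm_coe_le_norm ⟨z, hz⟩

/-- A bounded analytic function on the disc, as an element of `H^∞`. -/
noncomputable def HInfty.mk {g : ℂ → ℂ} (hg : DifferentiableOn ℂ g (ball 0 1)) (C : ℝ)
    (hC : ∀ z ∈ ball (0 : ℂ) 1, ‖g z‖ ≤ C) : HInfty :=
  ⟨BoundedContinuousFunction.ofNormedAddCommGroup (fun z : Disc => g z)
    (continuousOn_iff_continuous_domRestrict.1 hg.continuousOn) C fun z => hC z z.2, by
      refine hg.congr fun z hz => ?_
      rw [show z = ((⟨z, hz⟩ : Disc) : ℂ) from rfl, extendZero_coe]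
      rfl⟩

theorem HInfty.norm_mk_le {g : ℂ → ℂ} (hg : DifferentiableOn ℂ g (ball 0 1)) {C : ℝ}
    (hC : ∀ z ∈ ball (0 : ℂ) 1, ‖g z‖ ≤ C) (hC0 : 0 ≤ C) : ‖HInfty.mk hg C hC‖ ≤ C :=
  (BoundedContinuousFunction.norm_le hC0).2 fun z => hC z z.2

end HardyToeplitz

open HardyToeplitz in
theorem theorem2 (f : ℂ → ℂ) (hf : DifferentiableOn ℂ f (Metric.ball 0 1))
    (hf' : HardyToeplitz.MemH1 (deriv f)) :
    ∃ F : HardyToeplitz.HInfty,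
      (∀ z : HardyToeplitz.Disc, F.1 z = f z) ∧
      (∀ (h : HardyToeplitz.HInfty) (z : HardyToeplitz.Disc),
        CircleIntegrable
          (HardyToeplitz.toeplitzIntegrand f (HardyToeplitz.extendZero h.1) z) 0 1) ∧
      ∃ T : HardyToeplitz.HInfty →L[ℂ] HardyToeplitz.HInfty,
        (∀ (h : HardyToeplitz.HInfty) (z : HardyToeplitz.Disc),
          (T h).1 z = HardyToeplitz.toeplitz f (HardyToeplitz.extendZero h.1) z) ∧
        ‖T‖ ≤ ‖F‖ + Real.pi * HardyToeplitz.h1Norm (deriv f) := by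
  have hbd : ∀ z ∈ ball (0 : ℂ) 1, ‖f z‖ ≤ ‖f 0‖ + 2 * Real.pi * h1Norm (deriv f) := fun z hz => by
    have h1 := norm_sub_le_of_memH1_deriv hf hf' hz
    have h2 := norm_sub_norm_le (f z) (f 0)
    linarith
  let F : HInfty := HInfty.mk hf _ hbd
  -- The crude bound `hbd` only places `f` in `HInfty`; from here on its exact supremum norm is
  -- used, which gives the stated constant.
  have hA : ∀ z ∈ ball (0 : ℂ) 1, ‖f z‖ ≤ ‖F‖ := fun z hz => F.1.norm_coe_le_norm ⟨z, hz⟩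
  have hC0 : 0 ≤ ‖F‖ + Real.pi * h1Norm (deriv f) :=
    add_nonneg (norm_nonneg _) (mul_nonneg Real.pi_pos.le (h1Norm_nonneg _))
  have hb : ∀ (h : HInfty), ∀ z ∈ ball (0 : ℂ) 1, ‖toeplitz f (extendZero h.1) z‖
      ≤ (‖F‖ + Real.pi * h1Norm (deriv f)) * ‖h‖ := fun h z hz =>
    norm_toeplitz_le hf hf' hA h.2 (norm_extendZero_le h) hz
  let T₀ : HInfty →ₗ[ℂ] HInfty :=
    { toFun := fun h => HInfty.mk
        (differentiableOn_toeplitz hf hA h.2 (norm_extendZero_le h)) _ (hb h)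
      map_add' := fun h₁ h₂ => by
        refine Subtype.ext (BoundedContinuousFunction.ext fun z => ?_)
        have := toeplitz_add hf hA h₁.2 (norm_extendZero_le h₁) h₂.2 (norm_extendZero_le h₂) z.2
        rw [← extendZero_add] at this
        exact this
      map_smul' := fun c h => by
        refine Subtype.ext (BoundedContinuousFunction.ext fun z => ?_)
        have := toeplitz_smul hf hA h.2 (norm_extendZero_le h) c z.2
        rw [← extendZero_smul] at this
        exact this }
  have hT₀ : ∀ h, ‖T₀ h‖ ≤ (‖F‖ + Real.pi * h1Norm (deriv f)) * ‖h‖ := fun h =>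
    HInfty.norm_mk_le (differentiableOn_toeplitz hf hA h.2 (norm_extendZero_le h)) (hb h) (mul_nonneg hC0 (norm_nonneg h))
  exact ⟨F, fun z => rfl,
    fun h z => circleIntegrable_toeplitzIntegrand hf hA h.2 (norm_extendZero_le h) z.2,
    T₀.mkContinuous _ hT₀, fun h z => rfl, LinearMap.mkContinuous_norm_le _ hC0 _⟩
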